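/- Let $G$ be a Lie group, $H\subseteq G$ a closed subgroup, and $G/H$ the homogeneous space with its unique smooth structure for which $\pi\colon G\to G/H$ is a smooth submersion. Let $\mathfrak g=\mathfrak h\oplus\mathfrak m$ be a reductive decomposition (a direct sum of vector spaces with $\mathfrak m$ invariant under ${\rm Ad}(H)$), and identify $\mathfrak m\cong T_{eH}(G/H)$ via ${\rm d}\pi_e$. Let $\langle\cdot,\cdot\rangle$ be a $G$-invariant Riemannian metric on $G/H$ with Levi-Civita connection $\nabla$, and let $\nabla^0$ be the canonical connection of second kind, i.e. the $G$-invariant connection with $(\nabla^0_{X^\#}Y^\#)|_{eH}=-[X,Y]_{\mathfrak m}$ for $X,Y\in\mathfrak m$, where $X^\#$ is the action field of $X$ (with flow $(t,aH)\mapsto \exp(tX)aH$). Let $R,R^0$ be the curvature tensors of $\nabla,\nabla^0$ (with $R(X,Y)Z=\nabla_X\nabla_YZ-\nabla_Y\nabla_XZ-\nabla_{[X,Y]}Z$, similarly for $R^0$), let ${\rm Ric}(Y,Z)={\rm tr}(X\mapsto R(X,Y)Z)$, ${\rm s}={\rm tr}_{\langle\cdot,\cdot\rangle}{\rm Ric}$,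 and similarly ${\rm Ric}^0,{\rm s}^0$. Put $R^d=R-R^0$, ${\rm Ric}^d={\rm Ric}-{\rm Ric}^0$, ${\rm s}^d={\rm s}-{\rm s}^0$. Let $A$ be a $G$-invariant Codazzi tensor field on $G/H$, that is, a $G$-invariant smooth symmetric twice-covariant tensor field with $(\nabla_XA)(Y,Z)=(\nabla_YA)(X,Z)$ for all smooth vector fields $X,Y,Z$. Let $\lambda_1<\dots<\lambda_r$ be the distinct eigenvalues of $A_{eH}$ with respect to $\langle\cdot,\cdot\rangle$, and $\mathfrak m_1,\dots,\mathfrak m_r$ the corresponding eigenspaces, so that $\mathfrak m=\mathfrak m_1\oplus\dots\oplus\mathfrak m_r$. Then, for each $i$ and all $Y,Z\in\mathfrak m_i$, the endomorphism $X\mapsto R^d(X,Y)Z$ maps $\mathfrak m_i$ into itself. Let ${\rm Ric}^d_i(Y,Z)$ be the trace of its restriction to $\mathfrak m_i$ (the difference Ricci curvature of the leaf $M_i$ through $eH$ of the $\lambda_i$-eigendistribution of $A$), and let ${\rm s}^d_i$ be the trace of ${\rm Ric}^d_i$ with respect to $\langle\cdot,\cdot\rangle|_{\mathfrak m_i\times\mathfrak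 m_i}$. Moreover: (i) ${\rm Ric}^d(Y,Y)\le{\rm Ric}^d_j(Y,Y)$ for $j\in\{1,r\}$ and all $Y\in\mathfrak m_j$; (ii) ${\rm s}^d_1+\dots+{\rm s}^d_r={\rm s}^d$. -/

import Mathlib

open Bundle Set VectorField
open scoped Manifold ContDiff Topology

noncomputable section

set_option linter.unusedSectionVars false

namespace CodazziHomogeneous

/-! ### Smooth vector fields and curvature on a manifold without boundary -/

section Manifold

variable {E : Type*} [NormedAddCommGroup E] [NormedSpace ℝ E]
  {M : Type*} [TopologicalSpace M] [ChartedSpace E M] [IsManifold 𝓘(ℝ, E) ∞ M]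

/-- A (global) smooth vector field on `M`. -/
def IsSmoothField (X : Π x : M, TangentSpace 𝓘(ℝ, E) x) : Prop :=
  ContMDiff 𝓘(ℝ, E) 𝓘(ℝ, E).tangent ∞ (fun x ↦ (⟨x, X x⟩ : TangentBundle 𝓘(ℝ, E) M))

/-- The curvature operator on vector fields,
`R(X, Y) Z = ∇_X ∇_Y Z - ∇_Y ∇_X Z - ∇_{[X, Y]} Z`; in Mathlib `D Z x v` is `(∇_v Z)(x)`. -/
def curvatureOp (D : CovariantDerivative 𝓘(ℝ, E) E (TangentSpace 𝓘(ℝ, E) : M → Type _))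
    (X Y Z : Π x : M, TangentSpace 𝓘(ℝ, E) x) (x : M) : TangentSpace 𝓘(ℝ, E) x :=
  D (fun y ↦ D Z y (Y y)) x (X x) - D (fun y ↦ D Z y (X y)) x (Y x)
    - D Z x (mlieBracket 𝓘(ℝ, E) X Y x)

variable [FiniteDimensional ℝ E]

/-- A global smooth vector field with prescribed value `w` at `x`: the vector field which is
constant in the preferred trivialization at `x`, cut off by a smooth bump function. -/
def smoothExtend {x : M} (w : TangentSpace 𝓘(ℝ, E) x) (y : M) : TangentSpace 𝓘(ℝ, E) y :=
  (Classical.arbitrary (SmoothBumpFunction 𝓘(ℝ, E) x)) y • FiberBundle.extend E w y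

lemma smoothExtend_self {x : M} (w : TangentSpace 𝓘(ℝ, E) x) : smoothExtend w x = w := by
  simp [smoothExtend, SmoothBumpFunction.eq_one]

lemma isSmoothField_smoothExtend [T2Space M] {x : M} (w : TangentSpace 𝓘(ℝ, E) x) :
    IsSmoothField (smoothExtend w) := by
  have hs : ContMDiffOn 𝓘(ℝ, E) 𝓘(ℝ, E).tangent ∞
      (fun y ↦ (⟨y, FiberBundle.extend E w y⟩ : TangentBundle 𝓘(ℝ, E) M))
      (trivializationAt E (TangentSpace 𝓘(ℝ, E) : M → Type _) x).baseSet := by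
    intro y hy
    rw [Trivialization.contMDiffWithinAt_section _ hy]
    refine ContMDiffWithinAt.congr (f := fun _ : M ↦
      (trivializationAt E (TangentSpace 𝓘(ℝ, E) : M → Type _) x ⟨x, w⟩).2)
      contMDiffWithinAt_const (fun z hz ↦ ?_) ?_
    · rw [FiberBundle.extend, Trivialization.apply_mk_symm _ hz]
    · rw [FiberBundle.extend, Trivialization.apply_mk_symm _ hy]
  exact ContMDiffOn.smul_section_of_tsupport (SmoothBumpFunction.contMDiff _).contMDiffOn
    (Trivialization.open_baseSet _) (SmoothBumpFunction.tsupport_subset_chartAt_source _) hs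

variable (D : CovariantDerivative 𝓘(ℝ, E) E (TangentSpace 𝓘(ℝ, E) : M → Type _))
  [CovariantDerivative.ContMDiffCovariantDerivative D ∞]

lemma mdifferentiableAt_cov {Z X : Π x : M, TangentSpace 𝓘(ℝ, E) x} (hZ : IsSmoothField Z)
    {x : M} (hX : MDiffAt (T% X) x) : MDiffAt (T% (fun y ↦ D Z y (X y))) x := by
  have h := (CovariantDerivative.ContMDiffCovariantDerivative.contMDiff (cov := D) (k := ∞)).contMDiff
    (σ := Z) (by simpa using hZ.contMDiffOn)
  have h' := (h.contMDiffAt Filter.univ_mem : ContMDiffAt _ _ _ _ x).mdifferentiableAt (by simp)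
  exact h'.clm_bundle_apply hX

lemma curvatureOp_swap (X Y Z : Π x : M, TangentSpace 𝓘(ℝ, E) x) (x : M) :
    curvatureOp D Y X Z x = - curvatureOp D X Y Z x := by
  simp only [curvatureOp]
  rw [mlieBracket_swap]
  simp
  abel

lemma tensorialAt_curvatureOp_left (Y : Π x : M, TangentSpace 𝓘(ℝ, E) x)
    {Z : Π x : M, TangentSpace 𝓘(ℝ, E) x} (hZ : IsSmoothField Z) (x : M) :
    TensorialAt 𝓘(ℝ, E) E (curvatureOp D · Y Z x) x := by
  have := FiniteDimensional.complete ℝ E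
  constructor
  · intro f X hf hX
    have h := D.isCovariantDerivativeOnUniv.leibniz (mdifferentiableAt_cov D hZ hX) hf
    have e : (fun y ↦ D Z y ((f • X) y)) = f • (fun y ↦ D Z y (X y)) := by
      ext1 y; simp
    simp only [curvatureOp, e, h, mlieBracket_smul_left hf hX]
    simp
    module
  · intro X X' hX hX'
    have h := D.isCovariantDerivativeOnUniv.add (mdifferentiableAt_cov D hZ hX)
      (mdifferentiableAt_cov D hZ hX')
    have e : (fun y ↦ D Z y ((X + X') y)) = (fun y ↦ D Z y (X y)) + (fun y ↦ D Z y (X' y)) := by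
      ext1 y; simp
    simp only [curvatureOp, e, h, mlieBracket_add_left hX hX']
    simp
    abel

lemma tensorialAt_curvatureOp_right (X : Π x : M, TangentSpace 𝓘(ℝ, E) x)
    {Z : Π x : M, TangentSpace 𝓘(ℝ, E) x} (hZ : IsSmoothField Z) (x : M) :
    TensorialAt 𝓘(ℝ, E) E (curvatureOp D X · Z x) x := by
  have h := tensorialAt_curvatureOp_left D X hZ x
  constructor
  · intro f Y hf hY
    rw [curvatureOp_swap, h.smul hf hY, curvatureOp_swap D X Y, smul_neg, neg_neg]
  · intro Y Y' hY hY'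
    rw [curvatureOp_swap, h.add hY hY', curvatureOp_swap D X Y, curvatureOp_swap D X Y', neg_add,
      neg_neg, neg_neg]

variable [T2Space M]

/-- The curvature tensor of the smooth connection `D` at `x`:
`curvature D x w u v = R(u, v) w`, computed with any extensions of `u`, `v` to vector fields and a
smooth global extension of `w`. -/
def curvature (x : M) (w : TangentSpace 𝓘(ℝ, E) x) :
    TangentSpace 𝓘(ℝ, E) x →L[ℝ] TangentSpace 𝓘(ℝ, E) x →L[ℝ] TangentSpace 𝓘(ℝ, E) x :=
  TensorialAt.mkHom₂ (curvatureOp D · · (smoothExtend w) x) x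
    (fun Y _ ↦ tensorialAt_curvatureOp_left D Y (isSmoothField_smoothExtend w) x)
    (fun X _ ↦ tensorialAt_curvatureOp_right D X (isSmoothField_smoothExtend w) x)

lemma curvature_apply {X Y : Π x : M, TangentSpace 𝓘(ℝ, E) x} {x : M}
    (hX : MDiffAt (T% X) x) (hY : MDiffAt (T% Y) x) (w : TangentSpace 𝓘(ℝ, E) x) :
    curvature D x w (X x) (Y x) = curvatureOp D X Y (smoothExtend w) x :=
  TensorialAt.mkHom₂_apply _ _ hX hY

/-- The endomorphism `u ↦ B(u, v)` obtained from a bilinear map `B` by fixing its second argument. -/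
def fixSecond {x : M}
    (B : TangentSpace 𝓘(ℝ, E) x →L[ℝ] TangentSpace 𝓘(ℝ, E) x →L[ℝ] TangentSpace 𝓘(ℝ, E) x)
    (v : TangentSpace 𝓘(ℝ, E) x) :
    TangentSpace 𝓘(ℝ, E) x →ₗ[ℝ] TangentSpace 𝓘(ℝ, E) x where
  toFun u := B u v
  map_add' := by simp
  map_smul' := by simp

/-- The Ricci tensor of `D` at `x`: `Ric(v, w)` is the trace of `u ↦ R(u, v) w`. -/
def ricci (x : M) (v w : TangentSpace 𝓘(ℝ, E) x) : ℝ :=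
  LinearMap.trace ℝ (TangentSpace 𝓘(ℝ, E) x) (fixSecond (curvature D x w) v)

variable (D₀ : CovariantDerivative 𝓘(ℝ, E) E (TangentSpace 𝓘(ℝ, E) : M → Type _))
  [CovariantDerivative.ContMDiffCovariantDerivative D₀ ∞]

/-- The difference `R^d = R - R⁰` of the curvature tensors of `D` and `D₀`;
`curvatureDiff D D₀ x w u v = R^d(u, v) w`. -/
def curvatureDiff (x : M) (w : TangentSpace 𝓘(ℝ, E) x) :
    TangentSpace 𝓘(ℝ, E) x →L[ℝ] TangentSpace 𝓘(ℝ, E) x →L[ℝ] TangentSpace 𝓘(ℝ, E) x :=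
  curvature D x w - curvature D₀ x w

/-- The difference Ricci tensor `Ric^d = Ric - Ric⁰`. -/
def ricciDiff (x : M) (v w : TangentSpace 𝓘(ℝ, E) x) : ℝ :=
  ricci D x v w - ricci D₀ x v w

/-- `p` is invariant under the difference curvature: `R^d(u, v) w ∈ p` for `u, v, w ∈ p`. -/
def IsDiffInvariant (x : M) (p : Submodule ℝ (TangentSpace 𝓘(ℝ, E) x)) : Prop :=
  ∀ v ∈ p, ∀ w ∈ p, ∀ u ∈ p, curvatureDiff D D₀ x w u v ∈ p

/-- The difference Ricci tensor of a leaf with tangent space `p` at `x`: the trace of the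
restriction to `p` of the endomorphism `u ↦ R^d(u, v) w`. -/
def leafRicciDiff (x : M) (p : Submodule ℝ (TangentSpace 𝓘(ℝ, E) x))
    (hp : IsDiffInvariant D D₀ x p) (v w : p) : ℝ :=
  LinearMap.trace ℝ p
    ((fixSecond (curvatureDiff D D₀ x w.1) v.1).restrict (hp v.1 v.2 w.1 w.2))

instance (x : M) : FiniteDimensional ℝ (TangentSpace 𝓘(ℝ, E) x) :=
  inferInstanceAs (FiniteDimensional ℝ E)

/-- The trace `∑ₐ B(eₐ, eₐ)`, over an orthonormal basis, of a bilinear form `B` on a Euclidean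
space `V`. -/
def metricTrace {V : Type*} [NormedAddCommGroup V] [InnerProductSpace ℝ V]
    [FiniteDimensional ℝ V] (B : V → V → ℝ) : ℝ :=
  ∑ a, B (stdOrthonormalBasis ℝ V a) (stdOrthonormalBasis ℝ V a)

/-! ### Riemannian metrics and Codazzi tensor fields -/

variable [RiemannianBundle (fun x : M ↦ TangentSpace 𝓘(ℝ, E) x)]

/-- The scalar curvature of `D` with respect to the metric: the metric trace of its Ricci tensor. -/
def scalarCurvature (x : M) : ℝ := metricTrace (ricci D x)

/-- The difference scalar curvature `s^d = s - s⁰`. -/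
def scalarDiff (x : M) : ℝ := scalarCurvature D x - scalarCurvature D₀ x

/-- The difference scalar curvature of a leaf with tangent space `p` at `x`. -/
def leafScalarDiff (x : M) (p : Submodule ℝ (TangentSpace 𝓘(ℝ, E) x))
    (hp : IsDiffInvariant D D₀ x p) : ℝ := metricTrace (leafRicciDiff D D₀ x p hp)

/-- The eigenspace, for the eigenvalue `μ`, of a bilinear form `B` on `T_x M` with respect to the
metric. -/
def eigenspace (x : M)
    (B : TangentSpace 𝓘(ℝ, E) x →L[ℝ] TangentSpace 𝓘(ℝ, E) x →L[ℝ] ℝ) (μ : ℝ) :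
    Submodule ℝ (TangentSpace 𝓘(ℝ, E) x) where
  carrier := {u | ∀ v, B u v = μ * inner ℝ u v}
  add_mem' := by
    intro a b ha hb v
    simp only [Set.mem_ofPred_eq] at ha hb
    simp [ha, hb, inner_add_left, mul_add]
  zero_mem' := by intro v; simp
  smul_mem' := by
    intro c a ha v
    simp only [Set.mem_ofPred_eq] at ha
    simp [ha, inner_smul_left]
    ring

/-- `D` is the Levi-Civita connection of the metric: it is torsion-free, and
`X ⟨Y, Z⟩ = ⟨∇_X Y, Z⟩ + ⟨Y, ∇_X Z⟩`. -/
structure IsLeviCivita [CompleteSpace E] : Prop where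
  torsion_eq_zero : D.torsion = 0
  metric : ∀ (Y Z : Π x : M, TangentSpace 𝓘(ℝ, E) x) (x : M) (u : TangentSpace 𝓘(ℝ, E) x),
    MDiffAt (T% Y) x → MDiffAt (T% Z) x →
      mvfderiv 𝓘(ℝ, E) (fun y ↦ (inner ℝ (Y y) (Z y) : ℝ)) x u
        = inner ℝ (D Y x u) (Z x) + inner ℝ (Y x) (D Z x u)

/-- A twice-covariant symmetric smooth tensor field `A` is a Codazzi tensor field for `D` if
`(∇_X A)(Y, Z) = (∇_Y A)(X, Z)` for all smooth vector fields `X`, `Y`, `Z`, where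
`(∇_X A)(Y, Z) = X (A(Y, Z)) - A(∇_X Y, Z) - A(Y, ∇_X Z)`. -/
structure IsCodazzi (A : Π x : M, TangentSpace 𝓘(ℝ, E) x →L[ℝ] TangentSpace 𝓘(ℝ, E) x →L[ℝ] ℝ) :
    Prop where
  symm : ∀ x u v, A x u v = A x v u
  smooth : ContMDiff 𝓘(ℝ, E) (𝓘(ℝ, E).prod 𝓘(ℝ, E →L[ℝ] E →L[ℝ] ℝ)) ∞
    (fun x ↦ TotalSpace.mk' (E →L[ℝ] E →L[ℝ] ℝ)
      (E := fun x : M ↦ TangentSpace 𝓘(ℝ, E) x →L[ℝ] TangentSpace 𝓘(ℝ, E) x →L[ℝ] ℝ) x (A x))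
  codazzi : ∀ X Y Z : Π x : M, TangentSpace 𝓘(ℝ, E) x,
    IsSmoothField X → IsSmoothField Y → IsSmoothField Z → ∀ x : M,
      mvfderiv 𝓘(ℝ, E) (fun y ↦ A y (Y y) (Z y)) x (X x)
          - A x (D Y x (X x)) (Z x) - A x (Y x) (D Z x (X x))
        = mvfderiv 𝓘(ℝ, E) (fun y ↦ A y (X y) (Z y)) x (Y x)
          - A x (D X x (Y x)) (Z x) - A x (X x) (D Z x (Y x))

end Manifold

/-! ### Reductive homogeneous spaces -/

section Homogeneous

variable {E : Type*} [NormedAddCommGroup E] [NormedSpace ℝ E]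
  {F : Type*} [NormedAddCommGroup F] [NormedSpace ℝ F]
  {G : Type*} [TopologicalSpace G] [ChartedSpace E G] [Group G]

/-- The adjoint action of `a : G` on the Lie algebra of `G`: the derivative at the identity of
`g ↦ a * g * a⁻¹`. -/
def Ad (a : G) (X : GroupLieAlgebra 𝓘(ℝ, E) G) : GroupLieAlgebra 𝓘(ℝ, E) G :=
  mfderiv 𝓘(ℝ, E) 𝓘(ℝ, E) (fun g : G ↦ a * g * a⁻¹) 1 X

variable (H : Subgroup G) [ChartedSpace F (G ⧸ H)]

/-- The derivative `dπ_g : T_g G → T_{gH} (G/H)` of the projection `π : G → G/H`. -/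
def projDeriv (g : G) :
    TangentSpace 𝓘(ℝ, E) g →L[ℝ] TangentSpace 𝓘(ℝ, F) (g : G ⧸ H) :=
  mfderiv 𝓘(ℝ, E) 𝓘(ℝ, F) (fun g : G ↦ (g : G ⧸ H)) g

/-- The Lie algebra `𝔥 ⊆ 𝔤` of `H`: as `H` is the fibre of the submersion `π` over `eH`, its tangent
space at the identity is the kernel of `dπ_e`. -/
def isotropyAlgebra : Submodule ℝ (GroupLieAlgebra 𝓘(ℝ, E) G) :=
  (projDeriv (F := F) H (1 : G)).toLinearMap.ker

/-- `𝔤 = 𝔥 ⊕ 𝔪` is a reductive decomposition: a direct sum of vector spaces such that `𝔪` is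
`Ad(H)`-invariant. -/
structure IsReductiveDecomposition (𝔪 : Submodule ℝ (GroupLieAlgebra 𝓘(ℝ, E) G)) : Prop where
  isCompl : IsCompl (isotropyAlgebra (F := F) H) 𝔪
  ad_mem : ∀ h ∈ H, ∀ X ∈ 𝔪, Ad h X ∈ 𝔪

/-- The derivative `(dτ_a)_x : T_x (G/H) → T_{ax} (G/H)` of the left translation `τ_a`. -/
def translDeriv (a : G) (x : G ⧸ H) :
    TangentSpace 𝓘(ℝ, F) x →L[ℝ] TangentSpace 𝓘(ℝ, F) (a • x) :=
  mfderiv 𝓘(ℝ, F) 𝓘(ℝ, F) (fun y : G ⧸ H ↦ a • y) x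

/-- The action field `X^#` on `G/H` of `X ∈ 𝔤`, whose flow is `(t, x) ↦ exp(tX) • x`: its value at
`x` is the derivative at the identity of `g ↦ g • x`, applied to `X`. -/
def actionField (X : GroupLieAlgebra 𝓘(ℝ, E) G) (x : G ⧸ H) : TangentSpace 𝓘(ℝ, F) x :=
  mfderiv 𝓘(ℝ, E) 𝓘(ℝ, F) (fun g : G ↦ g • x) 1 X

/-- A twice-covariant tensor field on `G/H` is `G`-invariant. -/
def IsInvariantTensor
    (A : Π x : G ⧸ H, TangentSpace 𝓘(ℝ, F) x →L[ℝ] TangentSpace 𝓘(ℝ, F) x →L[ℝ] ℝ) : Prop :=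
  ∀ (a : G) (x : G ⧸ H) (u v : TangentSpace 𝓘(ℝ, F) x),
    A (a • x) (translDeriv H a x u) (translDeriv H a x v) = A x u v

/-- The Riemannian metric of `G/H` is `G`-invariant. -/
def IsInvariantMetric [RiemannianBundle (fun x : G ⧸ H ↦ TangentSpace 𝓘(ℝ, F) x)] : Prop :=
  ∀ (a : G) (x : G ⧸ H) (u v : TangentSpace 𝓘(ℝ, F) x),
    inner ℝ (translDeriv H a x u) (translDeriv H a x v) = inner ℝ u v

variable [IsManifold 𝓘(ℝ, F) ∞ (G ⧸ H)]
  (D : CovariantDerivative 𝓘(ℝ, F) F (TangentSpace 𝓘(ℝ, F) : G ⧸ H → Type _))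

/-- The connection `D` on `G/H` is `G`-invariant: if `W'` is the push-forward of `W` under the left
translation `τ_a`, then `∇_{dτ_a v} W' = dτ_a (∇_v W)`. -/
def IsInvariantConnection : Prop :=
  ∀ (a : G) (W W' : Π x : G ⧸ H, TangentSpace 𝓘(ℝ, F) x), IsSmoothField W → IsSmoothField W' →
    (∀ x, W' (a • x) = translDeriv H a x (W x)) →
    ∀ (x : G ⧸ H) (v : TangentSpace 𝓘(ℝ, F) x),
      D W' (a • x) (translDeriv H a x v) = translDeriv H a x (D W x v)

/-- `D` is the canonical connection of second kind of the reductive decomposition `𝔤 = 𝔥 ⊕ 𝔪`: the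
`G`-invariant connection whose product
`α(X, Y) = (∇_{X^#} Y^#)|_{eH} + [X, Y]_𝔪` on `𝔪 ≅ T_{eH} (G/H)` vanishes. Under this identification
(via `dπ_e`, with kernel `𝔥`) the vector `[X, Y]_𝔪` is `dπ_e [X, Y]`. -/
structure IsCanonicalConnection (𝔪 : Submodule ℝ (GroupLieAlgebra 𝓘(ℝ, E) G)) : Prop where
  invariant : IsInvariantConnection H D
  product_eq_zero : ∀ X ∈ 𝔪, ∀ Y ∈ 𝔪,
    D (actionField H Y) ((1 : G) : G ⧸ H) (actionField H X ((1 : G) : G ⧸ H))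
      + projDeriv (F := F) H (1 : G) ⁅X, Y⁆ = 0

end Homogeneous

end CodazziHomogeneous

end

set_option linter.unusedSectionVars false

/-! Write S_u v = ∇_u v - ∇⁰_u v for the difference tensor of the two connections. The geometry is
used only to reduce the theorem to linear algebra in the single Euclidean space T_{eH}(G/H).

The reduction rests on the principle that G-invariant tensors are ∇⁰-parallel: at the origin ∇⁰ is
plain differentiation in the frame obtained by translating T_{eH} along a local section of G → G/H
that is tangent to 𝔪 (`canonical_eq_flatDeriv`). The principle is applied three times. For the
metric, it shows that each S_u is skew. For A, it gives (∇_x A)(y, z) = -β(x, y, z) with β(x, y, z)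
= A(S_x y, z) + A(y, S_x z), so the Codazzi equation says exactly that β is totally symmetric. For S
itself, which is invariant because a metric connection is determined by its torsion, it gives R^d(u,
v) w = [S_u, S_v] w - S_{S_u v - S_v u} w.

Now let y, z be eigenvectors of A with eigenvalues l, m. Skewness yields β(x, y, z) = (m - l) ⟨S_x
y, z⟩. With the symmetry of β this forces S_x y ∈ 𝔪_i for x, y ∈ 𝔪_i, whence R^d preserves 𝔪_i.
Moreover, for Y ∈ 𝔪_j and an orthonormal eigenbasis e_p with eigenvalues μ_p, Ric^d(Y, Y) -
Ric^d_j(Y, Y) = ∑_{p,k} 2 β(e_p, Y, e_k)² / ((μ_k - λ_j)(μ_k - μ_p)), where vanishing denominators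
contribute 0 (`trace_sub_trace`). Adding the terms (p, k) and (k, p) gives -2β² / ((μ_k - λ_j)(μ_p -
λ_j)), which is nonpositive when λ_j is extremal; this is (i). If Y also runs through the basis, the
three cyclic permutations of each triple cancel, because 1/((c-a)(c-b)) + 1/((a-b)(a-c)) +
1/((b-c)(b-a)) = 0; this is (ii). -/

namespace CodazziHomogeneous

/-! ### Linear algebra of a skew tensor and a Codazzi form on a Euclidean space. -/

section Algebra

variable {V : Type*} [NormedAddCommGroup V] [InnerProductSpace ℝ V]

/-- A trilinear-type function which is skew in its last two arguments and symmetric in the first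
two vanishes. -/
lemma eq_zero_of_skew_of_symm {α : Type*} {B : α → α → α → ℝ}
    (hskew : ∀ x y z, B x y z = - B x z y) (hsymm : ∀ x y z, B x y z = B y x z) (x y z : α) :
    B x y z = 0 := by
  have h1 := hskew x y z
  have h2 := hsymm x z y
  have h3 := hskew z x y
  have h4 := hsymm z y x
  have h5 := hskew y z x
  have h6 := hsymm y x z
  linarith

/-- The curvature-like tensor `[S_u, S_v] w - S_{S_u v - S_v u} w`. -/
def algCurvature (S : V →ₗ[ℝ] V →ₗ[ℝ] V) (v w : V) : V →ₗ[ℝ] V where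
  toFun u := S u (S v w) - S v (S u w) - S (S u v - S v u) w
  map_add' := by intros; simp; abel
  map_smul' := by intros; simp [smul_sub]

lemma algCurvature_apply (S : V →ₗ[ℝ] V →ₗ[ℝ] V) (u v w : V) :
    algCurvature S v w u = S u (S v w) - S v (S u w) - S (S u v - S v u) w := rfl

/-- An algebraic model at a point: a tensor `S` of skew endomorphisms and a symmetric form `a` for
which the derivation `S_x · a` is symmetric in `x` and the first argument of the form. -/
structure IsAlgCodazzi (S : V →ₗ[ℝ] V →ₗ[ℝ] V) (a : V →ₗ[ℝ] V →ₗ[ℝ] ℝ) : Prop where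
  skew : ∀ x y z, inner ℝ (S x y) z = - inner ℝ y (S x z)
  symm : ∀ x y, a x y = a y x
  codazzi : ∀ x y z, a (S x y) z + a y (S x z) = a (S y x) z + a x (S y z)

/-- The derivation of the form `a` along `S_x`. -/
def derivForm (S : V →ₗ[ℝ] V →ₗ[ℝ] V) (a : V →ₗ[ℝ] V →ₗ[ℝ] ℝ) (x y z : V) : ℝ :=
  a (S x y) z + a y (S x z)

namespace IsAlgCodazzi

variable {S : V →ₗ[ℝ] V →ₗ[ℝ] V} {a : V →ₗ[ℝ] V →ₗ[ℝ] ℝ} (h : IsAlgCodazzi S a)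
include h

lemma derivForm_swap_left (x y z : V) : derivForm S a x y z = derivForm S a y x z :=
  h.codazzi x y z

/-- Together with `derivForm_swap_left` this makes the derived form totally symmetric, so a triple
of eigenvectors carries one number β that controls all components of S on it. -/
lemma derivForm_swap_right (x y z : V) : derivForm S a x y z = derivForm S a x z y := by
  simp only [derivForm]
  rw [h.symm (S x y) z, h.symm y (S x z)]
  ring

/-- Skewness of S_x merges the two terms of the derived form into one. Components of S between
different eigenspaces are therefore recovered from β, and β vanishes as soon as two of its arguments
share an eigenvalue. -/
lemma derivForm_eigen {y z : V} {l m : ℝ} (hy : ∀ v, a y v = l * inner ℝ y v)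
    (hz : ∀ v, a z v = m * inner ℝ z v) (x : V) :
    derivForm S a x y z = (m - l) * inner ℝ (S x y) z := by
  rw [derivForm, h.symm, hz, hy, real_inner_comm, ← neg_eq_iff_eq_neg.mpr (h.skew x y z)]
  ring

/-- One summand of the curvature component `⟨R(e, Y) Y, e⟩`, for eigenvectors `Y`, `e`, `f`. -/
lemma summand_eq {Y e f : V} {l p k : ℝ} (hY : ∀ v, a Y v = l * inner ℝ Y v)
    (he : ∀ v, a e v = p * inner ℝ e v) (hf : ∀ v, a f v = k * inner ℝ f v) (hp : p ≠ l) :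
    inner ℝ (S e Y) f * inner ℝ (S Y e) f
        - (inner ℝ (S e Y) f - inner ℝ (S Y e) f) * inner ℝ (S f Y) e
      = 2 * derivForm S a e Y f ^ 2 / ((k - l) * (k - p)) := by
  have h1 := h.derivForm_eigen hY hf e
  have h2 := h.derivForm_eigen he hf Y
  have h3 := h.derivForm_eigen hY he f
  rw [h.derivForm_swap_left] at h2
  rw [h.derivForm_swap_right, h.derivForm_swap_left, h.derivForm_swap_right] at h3
  set β := derivForm S a e Y f
  have hpl : p - l ≠ 0 := sub_ne_zero.mpr hp
  -- When two eigenvalues coincide β is zero and the right side is 0/0 = 0. The component of S that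
  -- is then not determined by β is multiplied by components that vanish.
  by_cases hkl : k = l
  · subst hkl
    have hβ : β = 0 := by simpa using h1
    rw [hβ] at h2 h3
    have e2 : inner ℝ (S Y e) f = 0 := by
      rcases mul_eq_zero.mp h2.symm with h' | h'
      · exact absurd (sub_eq_zero.mp h').symm hp
      · exact h'
    have e3 : inner ℝ (S f Y) e = 0 := (mul_eq_zero.mp h3.symm).resolve_left hpl
    simp [e2, e3]
  by_cases hkp : k = p
  · subst hkp
    have hβ : β = 0 := by simpa using h2
    rw [hβ] at h1 h3
    have e1 : inner ℝ (S e Y) f = 0 := (mul_eq_zero.mp h1.symm).resolve_left hpl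
    have e3 : inner ℝ (S f Y) e = 0 := (mul_eq_zero.mp h3.symm).resolve_left hpl
    simp [e1, e3]
  have hkl' : k - l ≠ 0 := sub_ne_zero.mpr hkl
  have hkp' : k - p ≠ 0 := sub_ne_zero.mpr hkp
  rw [eq_div_iff (mul_ne_zero hkl' hkp')]
  generalize inner ℝ (S e Y) f = s1 at *
  generalize inner ℝ (S Y e) f = s2 at *
  generalize inner ℝ (S f Y) e = s3 at *
  -- With three distinct eigenvalues all components are β over an eigenvalue difference, and s1 - s2
  -- is proportional to (p - l), which cancels the denominator of s3. The two products are then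
  -- equal, hence the factor 2.
  have e1 : s1 = β / (k - l) := by rw [h1]; field_simp
  have e2 : s2 = β / (k - p) := by rw [h2]; field_simp
  have e3 : s3 = β / (p - l) := by rw [h3]; field_simp
  rw [e1, e2, e3]
  field_simp
  ring

/-- The eigenspaces are invariant under the tensor `S`. -/
lemma inner_eq_zero {x y f : V} {l k : ℝ} (hx : ∀ v, a x v = l * inner ℝ x v)
    (hy : ∀ v, a y v = l * inner ℝ y v) (hf : ∀ v, a f v = k * inner ℝ f v) (hk : k ≠ l) :
    inner ℝ (S x y) f = 0 := by
  have h1 := h.derivForm_eigen hy hf x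
  have h2 := h.derivForm_eigen hy hx f
  rw [sub_self, zero_mul] at h2
  rw [h.derivForm_swap_right, h.derivForm_swap_left, h.derivForm_swap_right, h2] at h1
  exact (mul_eq_zero.mp h1.symm).resolve_left (sub_ne_zero.mpr hk)

variable [Fintype ι] (e : OrthonormalBasis ι ℝ V) {l : ι → ℝ}
  (he : ∀ i v, a (e i) v = l i * inner ℝ (e i) v)
include he

/-- Skewness turns each quadratic term of the curvature into a sum over the basis of products of
components of S. The term with S_Y Y drops out: S_Y Y and S_{e p} (e p) lie in different, hence
orthogonal, eigenspaces. -/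
lemma inner_algCurvature {Y : V} {m : ℝ} (hY : ∀ v, a Y v = m * inner ℝ Y v) {p : ι}
    (hp : l p ≠ m) :
    inner ℝ (algCurvature S Y Y (e p)) (e p)
      = ∑ k, 2 * derivForm S a (e p) Y (e k) ^ 2 / ((l k - m) * (l k - l p)) := by
  have h1 : inner ℝ (S (e p) (S Y Y)) (e p) = 0 := by
    rw [h.skew, ← e.sum_inner_mul_inner, neg_eq_zero]
    refine Finset.sum_eq_zero fun k _ ↦ ?_
    by_cases hk : l k = m
    · have : inner ℝ (e k) (S (e p) (e p)) = 0 := by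
        rw [real_inner_comm]
        exact h.inner_eq_zero (he p) (he p) (he k) (by rw [hk]; exact hp.symm)
      rw [this, mul_zero]
    · rw [h.inner_eq_zero hY hY (he k) hk, zero_mul]
  have h2 : inner ℝ (S Y (S (e p) Y)) (e p)
      = - ∑ k, inner ℝ (S (e p) Y) (e k) * inner ℝ (S Y (e p)) (e k) := by
    rw [h.skew, ← e.sum_inner_mul_inner]
    simp only [real_inner_comm]
  have h3 : inner ℝ (S (S (e p) Y - S Y (e p)) Y) (e p)
      = ∑ k, (inner ℝ (S (e p) Y) (e k) - inner ℝ (S Y (e p)) (e k)) * inner ℝ (S (e k) Y) (e p) := by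
    conv_lhs => rw [← e.sum_repr' (S (e p) Y - S Y (e p))]
    simp only [map_sum, LinearMap.sum_apply, sum_inner, map_smul, LinearMap.smul_apply,
      inner_smul_left, inner_sub_right]
    refine Finset.sum_congr rfl fun k _ ↦ ?_
    simp [real_inner_comm]
  rw [algCurvature_apply, inner_sub_left, inner_sub_left, h1, h2, h3, zero_sub, neg_neg,
    ← Finset.sum_sub_distrib]
  exact Finset.sum_congr rfl fun k _ ↦ h.summand_eq hY (he p) (he k) hp

lemma derivForm_eq_zero {Y : V} {m : ℝ} (hY : ∀ v, a Y v = m * inner ℝ Y v) {p : ι}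
    (hp : l p = m) (x : V) : derivForm S a x Y (e p) = 0 := by
  rw [h.derivForm_eigen hY (he p), hp, sub_self, zero_mul]

open Classical in
/-- The transverse part of the Ricci form in the direction of an eigenvector. -/
lemma sum_transverse {Y : V} {m : ℝ} (hY : ∀ v, a Y v = m * inner ℝ Y v) :
    ∑ p, (if l p = m then 0 else inner ℝ (algCurvature S Y Y (e p)) (e p))
      = ∑ p, ∑ k, 2 * derivForm S a (e p) Y (e k) ^ 2 / ((l k - m) * (l k - l p)) := by
  refine Finset.sum_congr rfl fun p _ ↦ ?_
  split_ifs with hp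
  · refine (Finset.sum_eq_zero fun k _ ↦ ?_).symm
    rw [h.derivForm_swap_left, h.derivForm_swap_right, h.derivForm_swap_left,
      h.derivForm_eq_zero e he hY hp]
    simp
  · exact h.inner_algCurvature e he hY hp

/-- The individual terms have no sign. Since β is symmetric in p and k, the sum may be symmetrised,
and each pair adds up to -2β² / ((l k - m)(l p - m)); for extremal m the two factors have the same
sign. -/
lemma sum_transverse_nonpos {Y : V} {m : ℝ} (hY : ∀ v, a Y v = m * inner ℝ Y v)
    (hm : (∀ p, m ≤ l p) ∨ (∀ p, l p ≤ m)) :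
    ∑ p, ∑ k, 2 * derivForm S a (e p) Y (e k) ^ 2 / ((l k - m) * (l k - l p)) ≤ 0 := by
  have hsym : ∀ p k, derivForm S a (e p) Y (e k) = derivForm S a (e k) Y (e p) := fun p k ↦ by
    rw [h.derivForm_swap_right, h.derivForm_swap_left, h.derivForm_swap_right]
  have key : ∀ p k, 2 * derivForm S a (e p) Y (e k) ^ 2 / ((l k - m) * (l k - l p))
      + 2 * derivForm S a (e k) Y (e p) ^ 2 / ((l p - m) * (l p - l k)) ≤ 0 := by
    intro p k
    rw [hsym k p]
    by_cases hk : l k = m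
    · rw [h.derivForm_eq_zero e he hY hk]; simp
    by_cases hp : l p = m
    · rw [hsym, h.derivForm_eq_zero e he hY hp]; simp
    -- Here β need not vanish, but both denominators do, so both quotients are 0 by convention.
    by_cases hkp : l k = l p
    · simp [hkp]
    have hk' := sub_ne_zero.mpr hk
    have hp' := sub_ne_zero.mpr hp
    have hkp' := sub_ne_zero.mpr hkp
    have hkp'' := sub_ne_zero.mpr (Ne.symm hkp)
    have : 2 * derivForm S a (e p) Y (e k) ^ 2 / ((l k - m) * (l k - l p))
      + 2 * derivForm S a (e p) Y (e k) ^ 2 / ((l p - m) * (l p - l k))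
      = - (2 * derivForm S a (e p) Y (e k) ^ 2 / ((l k - m) * (l p - m))) := by
      field_simp
      ring
    rw [this, neg_nonpos]
    refine div_nonneg (by positivity) ?_
    rcases hm with hm | hm
    · exact mul_nonneg (sub_nonneg.mpr (hm k)) (sub_nonneg.mpr (hm p))
    · exact mul_nonneg_of_nonpos_of_nonpos (sub_nonpos.mpr (hm k)) (sub_nonpos.mpr (hm p))
  have h2 := Finset.sum_nonpos fun p (_ : p ∈ Finset.univ) ↦
    Finset.sum_nonpos fun k (_ : k ∈ Finset.univ) ↦ key p k
  simp only [Finset.sum_add_distrib] at h2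
  -- Renaming the indices shows that the symmetrised sum is twice the original one.
  rw [Finset.sum_comm (f := fun p k ↦ 2 * derivForm S a (e k) Y (e p) ^ 2 /
    ((l p - m) * (l p - l k)))] at h2
  linarith

/-- The numerator is invariant under all permutations of (q, p, k), while the sum of the
coefficients over the three cyclic permutations is the partial fraction identity equal to 0. The
degenerate triples have β = 0. -/
lemma sum_transverse_eq_zero :
    ∑ q, ∑ p, ∑ k, 2 * derivForm S a (e p) (e q) (e k) ^ 2 / ((l k - l q) * (l k - l p)) = 0 := by
  have s1 : ∀ p q k, derivForm S a (e k) (e p) (e q) = derivForm S a (e p) (e q) (e k) := by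
    intro p q k
    rw [h.derivForm_swap_left, h.derivForm_swap_right]
  have key : ∀ q p k, 2 * derivForm S a (e p) (e q) (e k) ^ 2 / ((l k - l q) * (l k - l p))
      + 2 * derivForm S a (e k) (e p) (e q) ^ 2 / ((l q - l p) * (l q - l k))
      + 2 * derivForm S a (e q) (e k) (e p) ^ 2 / ((l p - l k) * (l p - l q)) = 0 := by
    intro q p k
    rw [← s1 q k p, s1 p q k]
    by_cases h1 : l k = l q
    · rw [h.derivForm_eq_zero e he (he q) h1]; simp
    by_cases h2 : l k = l p
    · rw [h.derivForm_swap_left, h.derivForm_eq_zero e he (he p) h2]; simp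
    by_cases h3 : l p = l q
    · rw [h.derivForm_swap_right, h.derivForm_swap_left, h.derivForm_swap_right,
        h.derivForm_eq_zero e he (he q) h3]; simp
    have := sub_ne_zero.mpr h1
    have := sub_ne_zero.mpr h2
    have := sub_ne_zero.mpr h3
    have := sub_ne_zero.mpr (Ne.symm h1)
    have := sub_ne_zero.mpr (Ne.symm h2)
    have := sub_ne_zero.mpr (Ne.symm h3)
    field_simp
    ring
  set f : ι → ι → ι → ℝ := fun q p k ↦
    2 * derivForm S a (e p) (e q) (e k) ^ 2 / ((l k - l q) * (l k - l p)) with hf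
  -- Both cyclic relabellings leave the triple sum unchanged, so three times the sum vanishes.
  have e1 : ∑ q, ∑ p, ∑ k, f p k q = ∑ q, ∑ p, ∑ k, f q p k := by
    rw [Finset.sum_comm]
    exact Finset.sum_congr rfl fun p _ ↦ Finset.sum_comm
  have e2 : ∑ q, ∑ p, ∑ k, f k q p = ∑ q, ∑ p, ∑ k, f q p k := by
    calc ∑ q, ∑ p, ∑ k, f k q p = ∑ q, ∑ k, ∑ p, f k q p :=
          Finset.sum_congr rfl fun q _ ↦ Finset.sum_comm
      _ = ∑ q, ∑ p, ∑ k, f q p k := Finset.sum_comm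
  have h0 : ∑ q, ∑ p, ∑ k, (f q p k + f p k q + f k q p) = 0 :=
    Finset.sum_eq_zero fun q _ ↦ Finset.sum_eq_zero fun p _ ↦ Finset.sum_eq_zero fun k _ ↦ key q p k
  simp only [Finset.sum_add_distrib, e1, e2] at h0
  linarith

end IsAlgCodazzi

/-- A finite sum of the diagonal values of a bilinear form over an orthonormal basis does not depend
on the basis. -/
lemma sum_diag_eq [Fintype ι] [Fintype κ] (B : V →ₗ[ℝ] V →ₗ[ℝ] ℝ) (e : OrthonormalBasis ι ℝ V)
    (f : OrthonormalBasis κ ℝ V) : ∑ i, B (e i) (e i) = ∑ k, B (f k) (f k) := by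
  have h1 : ∀ i, B (e i) (e i) = ∑ k, inner ℝ (f k) (e i) * B (f k) (e i) := fun i ↦
    calc B (e i) (e i) = B (∑ k, inner ℝ (f k) (e i) • f k) (e i) := by rw [f.sum_repr']
      _ = _ := by simp only [map_sum, LinearMap.sum_apply, map_smul, LinearMap.smul_apply,
        smul_eq_mul]
  have h2 : ∀ k, B (f k) (f k) = ∑ i, inner ℝ (e i) (f k) * B (f k) (e i) := fun k ↦ by
    conv_lhs => enter [2]; rw [← e.sum_repr' (f k)]
    simp
  simp only [h1, h2]
  rw [Finset.sum_comm]
  simp only [real_inner_comm]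

/-! ### Eigenspace decomposition and the two trace statements in the algebraic model. -/

section Spectral

variable [FiniteDimensional ℝ V] {S : V →ₗ[ℝ] V →ₗ[ℝ] V} {a : V →ₗ[ℝ] V →ₗ[ℝ] ℝ} {r : ℕ}
  {ev : Fin r → ℝ} {m : Fin r → Submodule ℝ V}

omit [FiniteDimensional ℝ V] in
lemma orthogonalFamily_eigen (hsymm : ∀ x y, a x y = a y x) (hinj : Function.Injective ev)
    (hm : ∀ i u, u ∈ m i ↔ ∀ v, a u v = ev i * inner ℝ u v) :
    OrthogonalFamily ℝ (fun i ↦ m i) (fun i ↦ (m i).subtypeₗᵢ) := by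
  intro i j hij u v
  have h1 := (hm i u).1 u.2 v
  have h2 := (hm j v).1 v.2 u
  rw [hsymm, h1, real_inner_comm (u : V) (v : V)] at h2
  have h3 : (ev i - ev j) * inner ℝ (u : V) (v : V) = 0 := by linarith
  exact (mul_eq_zero.mp h3).resolve_left (sub_ne_zero.mpr fun h' ↦ hij (hinj h'))

/-- A symmetric bilinear form on a Euclidean space is diagonalizable. -/
lemma isInternal_eigen (hsymm : ∀ x y, a x y = a y x) (hinj : Function.Injective ev)
    (hm : ∀ i u, u ∈ m i ↔ ∀ v, a u v = ev i * inner ℝ u v)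
    (hev : ∀ (μ : ℝ) (u : V), u ≠ 0 → (∀ v, a u v = μ * inner ℝ u v) → μ ∈ Set.range ev) :
    DirectSum.IsInternal m := by
  classical
  let b := stdOrthonormalBasis ℝ V
  -- T is the endomorphism representing a through the inner product; it brings in the spectral
  -- theorem for symmetric operators.
  let T : V →ₗ[ℝ] V := ∑ i, (a.flip (b i)).smulRight (b i)
  have hT : ∀ u v, inner ℝ (T u) v = a u v := fun u v ↦ by
    conv_rhs => rw [← b.sum_repr' v]
    simp [T, sum_inner, inner_smul_left, mul_comm]
  have hTs : T.IsSymmetric := fun u v ↦ by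
    rw [hT, real_inner_comm, hT, hsymm]
  rw [(orthogonalFamily_eigen hsymm hinj hm).isInternal_iff, eq_bot_iff,
    ← hTs.orthogonalComplement_iSup_eigenspaces_eq_bot]
  refine Submodule.orthogonal_le (iSup_le fun μ u hu ↦ ?_)
  by_cases hu0 : u = 0
  · rw [hu0]; exact zero_mem _
  have hau : ∀ v, a u v = μ * inner ℝ u v := fun v ↦ by
    rw [← hT, Module.End.mem_eigenspace_iff.mp hu, real_inner_smul_left]
  obtain ⟨i, rfl⟩ := hev μ u hu0 hau
  exact Submodule.mem_iSup_of_mem i ((hm i u).2 hau)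

/-- The standard orthonormal bases of the eigenspaces assemble to one of the whole space. -/
lemma exists_eigenBasis (hsymm : ∀ x y, a x y = a y x) (hinj : Function.Injective ev)
    (hm : ∀ i u, u ∈ m i ↔ ∀ v, a u v = ev i * inner ℝ u v)
    (hev : ∀ (μ : ℝ) (u : V), u ≠ 0 → (∀ v, a u v = μ * inner ℝ u v) → μ ∈ Set.range ev) :
    ∃ e : OrthonormalBasis (Σ i, Fin (Module.finrank ℝ (m i))) ℝ V,
      ∀ p, e p = (stdOrthonormalBasis ℝ (m p.1) p.2 : V) :=
  ⟨(isInternal_eigen hsymm hinj hm hev).collectedOrthonormalBasis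
    (orthogonalFamily_eigen hsymm hinj hm) (fun i ↦ stdOrthonormalBasis ℝ (m i)), fun p ↦ by
    simp [DirectSum.IsInternal.collectedOrthonormalBasis]⟩

namespace IsAlgCodazzi

variable (h : IsAlgCodazzi S a) (hmono : StrictMono ev)
  (hm : ∀ i u, u ∈ m i ↔ ∀ v, a u v = ev i * inner ℝ u v)
  (hev : ∀ (μ : ℝ) (u : V), u ≠ 0 → (∀ v, a u v = μ * inner ℝ u v) → μ ∈ Set.range ev)
include h hmono hm hev

lemma apply_mem {i : Fin r} {x y : V} (hx : x ∈ m i) (hy : y ∈ m i) : S x y ∈ m i := by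
  obtain ⟨e, he⟩ := exists_eigenBasis h.symm hmono.injective hm hev
  have hmem : ∀ p, e p ∈ m p.1 := fun p ↦ by rw [he]; exact Subtype.coe_prop _
  rw [← e.sum_repr' (S x y)]
  refine Submodule.sum_mem _ fun p _ ↦ ?_
  by_cases hp : p.1 = i
  · exact Submodule.smul_mem _ _ (hp ▸ hmem p)
  · rw [real_inner_comm, h.inner_eq_zero ((hm i x).1 hx) ((hm i y).1 hy)
      ((hm _ _).1 (hmem p)) (fun h' ↦ hp (hmono.injective h')), zero_smul]
    exact zero_mem _

lemma algCurvature_mem {i : Fin r} {v w : V} (hv : v ∈ m i) (hw : w ∈ m i) {u : V}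
    (hu : u ∈ m i) : algCurvature S v w u ∈ m i := by
  have hS : ∀ {x y : V}, x ∈ m i → y ∈ m i → S x y ∈ m i := fun hx hy ↦
    h.apply_mem hmono hm hev hx hy
  rw [algCurvature_apply]
  exact sub_mem (sub_mem (hS hu (hS hv hw)) (hS hv (hS hu hw)))
    (hS (sub_mem (hS hu hv) (hS hv hu)) hw)

omit hev in
-- In a basis adapted to the eigenspaces, the diagonal entries with eigenvalue `ev j` make up the
-- trace of the restriction. Only the transverse entries survive the subtraction, and those are the
-- sums computed above.
lemma trace_sub_trace (e : OrthonormalBasis (Σ i, Fin (Module.finrank ℝ (m i))) ℝ V)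
    (he : ∀ p, e p = (stdOrthonormalBasis ℝ (m p.1) p.2 : V)) {j : Fin r} {Y : V} (hY : Y ∈ m j)
    (hmaps : ∀ u ∈ m j, algCurvature S Y Y u ∈ m j) :
    LinearMap.trace ℝ V (algCurvature S Y Y)
        - LinearMap.trace ℝ (m j) ((algCurvature S Y Y).restrict hmaps)
      = ∑ p, ∑ k, 2 * derivForm S a (e p) Y (e k) ^ 2
          / ((ev k.1 - ev j) * (ev k.1 - ev p.1)) := by
  classical
  have hmem : ∀ p, e p ∈ m p.1 := fun p ↦ by rw [he]; exact Subtype.coe_prop _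
  rw [← h.sum_transverse e (l := fun p ↦ ev p.1) (fun p ↦ (hm _ _).1 (hmem p)) ((hm j Y).1 hY),
    LinearMap.trace_eq_sum_inner _ e,
    LinearMap.trace_eq_sum_inner _ (stdOrthonormalBasis ℝ (m j)), sub_eq_iff_eq_add]
  have hsum : ∑ b, inner ℝ (stdOrthonormalBasis ℝ (m j) b)
      ((algCurvature S Y Y).restrict hmaps (stdOrthonormalBasis ℝ (m j) b))
      = ∑ p, if ev p.1 = ev j then inner ℝ (algCurvature S Y Y (e p)) (e p) else 0 := by
    rw [Fintype.sum_sigma, Finset.sum_eq_single j]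
    · refine Finset.sum_congr rfl fun b _ ↦ ?_
      rw [if_pos rfl, he, real_inner_comm]
      rfl
    · intro i _ hi
      refine Finset.sum_eq_zero fun b _ ↦ if_neg fun h' ↦ hi (hmono.injective h')
    · simp
  rw [hsum, ← Finset.sum_add_distrib]
  refine Finset.sum_congr rfl fun p _ ↦ ?_
  rw [real_inner_comm]
  split_ifs <;> simp

theorem trace_le_trace {j : Fin r} (hj : (j : ℕ) = 0 ∨ (j : ℕ) + 1 = r) {Y : V} (hY : Y ∈ m j)
    (hmaps : ∀ u ∈ m j, algCurvature S Y Y u ∈ m j) :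
    LinearMap.trace ℝ V (algCurvature S Y Y)
      ≤ LinearMap.trace ℝ (m j) ((algCurvature S Y Y).restrict hmaps) := by
  obtain ⟨e, he⟩ := exists_eigenBasis h.symm hmono.injective hm hev
  rw [← sub_nonpos, h.trace_sub_trace hmono hm e he hY hmaps]
  refine h.sum_transverse_nonpos e (l := fun p ↦ ev p.1) (fun p ↦ (hm _ _).1 ?_)
    ((hm j Y).1 hY) ?_
  · rw [he]; exact Subtype.coe_prop _
  -- The index 0 carries the least eigenvalue and the index r - 1 the greatest.
  · rcases hj with hj | hj
    · exact Or.inl fun p ↦ hmono.monotone (Fin.le_def.mpr (by omega))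
    · exact Or.inr fun p ↦ hmono.monotone (Fin.le_def.mpr (by omega))

theorem sum_trace_eq (hmaps : ∀ i, ∀ v ∈ m i, ∀ w ∈ m i, ∀ u ∈ m i, algCurvature S v w u ∈ m i) :
    ∑ i, metricTrace (fun v w : m i ↦
        LinearMap.trace ℝ (m i) ((algCurvature S v.1 w.1).restrict (hmaps i v.1 v.2 w.1 w.2)))
      = metricTrace (fun v w : V ↦ LinearMap.trace ℝ V (algCurvature S v w)) := by
  obtain ⟨e, he⟩ := exists_eigenBasis h.symm hmono.injective hm hev
  have hmem : ∀ p, e p ∈ m p.1 := fun p ↦ by rw [he]; exact Subtype.coe_prop _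
  -- The Ricci form is bilinear, so its metric trace may be taken in the eigenbasis in place of the
  -- standard basis of V.
  let B : V →ₗ[ℝ] V →ₗ[ℝ] ℝ := LinearMap.mk₂ ℝ
    (fun v w ↦ LinearMap.trace ℝ V (algCurvature S v w))
    (fun v v' w ↦ by rw [← map_add]; congr 1; ext u; simp [algCurvature_apply]; abel)
    (fun c v w ↦ by rw [← map_smul]; congr 1; ext u; simp [algCurvature_apply, smul_sub])
    (fun v w w' ↦ by rw [← map_add]; congr 1; ext u; simp [algCurvature_apply]; abel)
    (fun c v w ↦ by rw [← map_smul]; congr 1; ext u; simp [algCurvature_apply, smul_sub])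
  have h1 : metricTrace (fun v w : V ↦ LinearMap.trace ℝ V (algCurvature S v w))
      = ∑ p, LinearMap.trace ℝ V (algCurvature S (e p) (e p)) :=
    sum_diag_eq B (stdOrthonormalBasis ℝ V) e
  have h2 : ∑ i, metricTrace (fun v w : m i ↦
        LinearMap.trace ℝ (m i) ((algCurvature S v.1 w.1).restrict (hmaps i v.1 v.2 w.1 w.2)))
      = ∑ p, LinearMap.trace ℝ (m p.1) ((algCurvature S (e p) (e p)).restrict
          (hmaps p.1 _ (hmem p) _ (hmem p))) := by
    -- The restricted maps depend on membership proofs, so the equality of basis vectors is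
    -- substituted rather than rewritten.
    have aux : ∀ (i : Fin r) (x y : V) (hx : x ∈ m i) (hy : y ∈ m i), x = y →
        LinearMap.trace ℝ (m i) ((algCurvature S x x).restrict (hmaps i x hx x hx))
          = LinearMap.trace ℝ (m i) ((algCurvature S y y).restrict (hmaps i y hy y hy)) := by
      rintro i x _ hx hy rfl
      rfl
    rw [Fintype.sum_sigma]
    simp only [metricTrace]
    exact Finset.sum_congr rfl fun i _ ↦ Finset.sum_congr rfl fun b _ ↦
      aux i _ _ (Subtype.coe_prop _) (hmem ⟨i, b⟩) (he ⟨i, b⟩).symm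
  rw [h1, h2, ← sub_eq_zero, ← neg_eq_zero, neg_sub, ← Finset.sum_sub_distrib,
    ← h.sum_transverse_eq_zero e (l := fun p ↦ ev p.1) (fun p ↦ (hm _ _).1 (hmem p))]
  exact Finset.sum_congr rfl fun p _ ↦ h.trace_sub_trace hmono hm e he (hmem p) _

end IsAlgCodazzi

end Spectral

end Algebra

/-! ### Calculus of vector fields in the preferred trivialization. -/

section LocalRep

variable {E : Type*} [NormedAddCommGroup E] [NormedSpace ℝ E]
  {M : Type*} [TopologicalSpace M] [ChartedSpace E M] [IsManifold 𝓘(ℝ, E) ∞ M]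

/-- The local representative, in the preferred trivialization at `x`, of a vector field. -/
noncomputable def localRep (x : M) (V : Π y : M, TangentSpace 𝓘(ℝ, E) y) (y : M) : E :=
  (trivializationAt E (TangentSpace 𝓘(ℝ, E) : M → Type _) x ⟨y, V y⟩).2

lemma trivializationAt_self_snd (x : M) (v : TangentSpace 𝓘(ℝ, E) x) :
    (trivializationAt E (TangentSpace 𝓘(ℝ, E) : M → Type _) x ⟨x, v⟩).2 = v :=
  tangentCoordChange_self (I := 𝓘(ℝ, E)) (mem_extChartAt_source x)

lemma localRep_self (x : M) (V : Π y : M, TangentSpace 𝓘(ℝ, E) y) : localRep x V x = V x :=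
  trivializationAt_self_snd x (V x)

lemma localRep_add (x : M) (V W : Π y : M, TangentSpace 𝓘(ℝ, E) y) :
    localRep x (V + W) = localRep x V + localRep x W :=
  funext fun y ↦ map_add (tangentCoordChange 𝓘(ℝ, E) y x y) (V y) (W y)

lemma localRep_smul (x : M) (g : M → ℝ) (V : Π y : M, TangentSpace 𝓘(ℝ, E) y) :
    localRep x (g • V) = g • localRep x V :=
  funext fun y ↦ map_smul (tangentCoordChange 𝓘(ℝ, E) y x y) (g y) (V y)

lemma trivializationAt_snd_eq_mfderiv {x y : M} (hy : y ∈ (chartAt E x).source)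
    (v : TangentSpace 𝓘(ℝ, E) y) :
    (trivializationAt E (TangentSpace 𝓘(ℝ, E) : M → Type _) x ⟨y, v⟩).2
      = mfderiv 𝓘(ℝ, E) 𝓘(ℝ, E) (extChartAt 𝓘(ℝ, E) x) y v := by
  have : IsManifold 𝓘(ℝ, E) 1 M := IsManifold.of_le (n := ∞) (by simp)
  have h1 := congrArg (fun L : E →L[ℝ] E ↦ L v)
    (TangentBundle.continuousLinearMapAt_trivializationAt (I := 𝓘(ℝ, E)) hy)
  have h2 := congrArg (fun L : E →L[ℝ] E ↦ L v)
    (TangentBundle.continuousLinearMapAt_trivializationAt_eq_core (I := 𝓘(ℝ, E)) hy)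
  exact (h2.symm.trans h1)

lemma mdifferentiableAt_localRep_iff {x : M} {V : Π y : M, TangentSpace 𝓘(ℝ, E) y} :
    MDiffAt (localRep x V) x ↔ MDiffAt (T% V) x :=
  (mdifferentiableAt_section 𝓘(ℝ, E) V).symm

variable {F' : Type*} [NormedAddCommGroup F'] [NormedSpace ℝ F']

omit [IsManifold 𝓘(ℝ, E) ∞ M] in
lemma mvfderiv_congr {f g : M → F'} {x : M} (h : f =ᶠ[𝓝 x] g) :
    mvfderiv 𝓘(ℝ, E) f x = mvfderiv 𝓘(ℝ, E) g x :=
  h.mfderiv_eq (I := 𝓘(ℝ, E)) (I' := 𝓘(ℝ, F'))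

omit [IsManifold 𝓘(ℝ, E) ∞ M] in
lemma mvfderiv_eq_fderiv {f : M → F'} {x : M} (hf : MDiffAt f x) :
    mvfderiv 𝓘(ℝ, E) f x
      = fderiv ℝ (f ∘ (extChartAt 𝓘(ℝ, E) x).symm) (extChartAt 𝓘(ℝ, E) x x) := by
  have h := hf.mfderiv
  rw [ModelWithCorners.range_eq_univ, fderivWithin_univ] at h
  exact h

omit [IsManifold 𝓘(ℝ, E) ∞ M] in
lemma mdifferentiableAt_iff_differentiableAt {f : M → F'} {x : M} (hf : ContinuousAt f x) :
    MDiffAt f x ↔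
      DifferentiableAt ℝ (f ∘ (extChartAt 𝓘(ℝ, E) x).symm) (extChartAt 𝓘(ℝ, E) x x) := by
  rw [mdifferentiableAt_iff, and_iff_right hf, ModelWithCorners.range_eq_univ,
    differentiableWithinAt_univ]
  rfl

/-- The bracket is defined by pulling the fields back through the inverse chart. Near the centre
these pullbacks are the local representatives, since the trivialization is the differential of the
chart, and at the centre that differential is the identity. -/
lemma mlieBracket_eq_mvfderiv_localRep {x : M} {V W : Π y : M, TangentSpace 𝓘(ℝ, E) y}
    (hV : MDiffAt (T% V) x) (hW : MDiffAt (T% W) x) :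
    mlieBracket 𝓘(ℝ, E) V W x = (mvfderiv 𝓘(ℝ, E) (localRep x W) x (V x)
      - mvfderiv 𝓘(ℝ, E) (localRep x V) x (W x) : E) := by
  have : IsManifold 𝓘(ℝ, E) 1 M := IsManifold.of_le (n := ∞) (by simp)
  have key : ∀ U : Π y : M, TangentSpace 𝓘(ℝ, E) y,
      mpullbackWithin 𝓘(ℝ, E) 𝓘(ℝ, E) (extChartAt 𝓘(ℝ, E) x).symm U univ
        =ᶠ[𝓝 (extChartAt 𝓘(ℝ, E) x x)] (localRep x U ∘ (extChartAt 𝓘(ℝ, E) x).symm) := by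
    intro U
    filter_upwards [extChartAt_target_mem_nhds (I := 𝓘(ℝ, E)) x] with ξ hξ
    have hy : (extChartAt 𝓘(ℝ, E) x).symm ξ ∈ (chartAt E x).source := by
      have := (extChartAt 𝓘(ℝ, E) x).map_target hξ
      rwa [extChartAt_source] at this
    refine Eq.trans ?_ (trivializationAt_snd_eq_mfderiv hy _).symm
    have h1 := mfderivWithin_extChartAt_symm_comp_mfderiv_extChartAt hξ
    have h2 := mfderiv_extChartAt_comp_mfderivWithin_extChartAt_symm hξ
    rw [ModelWithCorners.range_eq_univ] at h1 h2
    exact congrArg (fun L ↦ L (U _)) (ContinuousLinearMap.inverse_eq h1 h2)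
  rw [mvfderiv_eq_fderiv (mdifferentiableAt_localRep_iff.2 hV),
    mvfderiv_eq_fderiv (mdifferentiableAt_localRep_iff.2 hW), ← (key V).fderiv_eq,
    ← (key W).fderiv_eq]
  have e : ∀ U : Π y : M, TangentSpace 𝓘(ℝ, E) y,
    mpullbackWithin 𝓘(ℝ, E) 𝓘(ℝ, E) (extChartAt 𝓘(ℝ, E) x).symm U univ
      (extChartAt 𝓘(ℝ, E) x x) = U x := fun U ↦ by
    rw [(key U).eq_of_nhds, Function.comp_apply, extChartAt_to_inv, localRep_self]
  rw [← mlieBracketWithin_univ, mlieBracketWithin_apply, mfderiv_extChartAt_self,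
    ModelWithCorners.range_eq_univ, preimage_univ, univ_inter]
  have hb : ∀ (v w : E → E) (p : E),
      lieBracketWithin ℝ v w univ p = fderiv ℝ w p (v p) - fderiv ℝ v p (w p) := by
    intro v w p
    rw [lieBracketWithin_univ]
    rfl
  refine (congrArg (fun L : E →L[ℝ] E ↦ L _) ContinuousLinearMap.inverse_id).trans ?_
  exact (hb _ _ _).trans
    (congrArg₂ (fun a b : E ↦ a - b) (congrArg _ (e V)) (congrArg _ (e W)))

omit [IsManifold 𝓘(ℝ, E) ∞ M] in
lemma eventually_symm_extChartAt_eq {x : M} :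
    ∀ᶠ y in 𝓝 x, (extChartAt 𝓘(ℝ, E) x).symm (extChartAt 𝓘(ℝ, E) x y) = y := by
  filter_upwards [extChartAt_source_mem_nhds (I := 𝓘(ℝ, E)) x] with y hy
  exact (extChartAt 𝓘(ℝ, E) x).left_inv hy

lemma hasMFDerivAt_of_eventuallyEq_comp_extChartAt {g : M → F'} {x : M} {h : E → F'}
    {L : E →L[ℝ] F'}
    (hh : HasFDerivAt h L (extChartAt 𝓘(ℝ, E) x x))
    (hg : g =ᶠ[𝓝 x] h ∘ extChartAt 𝓘(ℝ, E) x) :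
    MDiffAt g x ∧ mvfderiv 𝓘(ℝ, E) g x = L := by
  have : IsManifold 𝓘(ℝ, E) 1 M := IsManifold.of_le (n := ∞) (by simp)
  have h1 := (hasMFDerivAt_extChartAt (I := 𝓘(ℝ, E)) (mem_chart_source E x))
  have h2 := (hh.hasMFDerivAt.comp x h1).congr_of_eventuallyEq hg
  have h3 : mfderiv 𝓘(ℝ, E) 𝓘(ℝ, E) (extChartAt 𝓘(ℝ, E) x) x = ContinuousLinearMap.id ℝ E :=
    mfderiv_extChartAt_self
  refine ⟨h2.mdifferentiableAt, ?_⟩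
  have h4 := h2.mfderiv
  have h5 : (L ∘L (ContinuousLinearMap.id ℝ E)) = L := L.comp_id
  refine Eq.trans ?_ h5
  rw [← h3]
  refine h4.trans ?_
  congr 1

omit [IsManifold 𝓘(ℝ, E) ∞ M] in
lemma contDiffAt_comp_extChartAt_symm {f : M → F'} {x : M} {n : ℕ}
    (hf : ContMDiffAt 𝓘(ℝ, E) 𝓘(ℝ, F') n f x) :
    ContDiffAt ℝ n (f ∘ (extChartAt 𝓘(ℝ, E) x).symm) (extChartAt 𝓘(ℝ, E) x x) := by
  have h1 := (contMDiffAt_iff.1 hf).2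
  rw [ModelWithCorners.range_eq_univ, contDiffWithinAt_univ] at h1
  exact h1

lemma mvfderiv_eventuallyEq_fderiv {f : M → F'} {x : M}
    (hf : ContMDiffAt 𝓘(ℝ, E) 𝓘(ℝ, F') 1 f x) (V : Π y : M, TangentSpace 𝓘(ℝ, E) y) :
    (fun y ↦ mvfderiv 𝓘(ℝ, E) f y (V y)) =ᶠ[𝓝 x] fun y ↦
      fderiv ℝ (f ∘ (extChartAt 𝓘(ℝ, E) x).symm) (extChartAt 𝓘(ℝ, E) x y) (localRep x V y) := by
  have : IsManifold 𝓘(ℝ, E) 1 M := IsManifold.of_le (n := ∞) (by simp)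
  have hf' := (contDiffAt_comp_extChartAt_symm (n := 1) hf).eventually (by simp)
  filter_upwards [chart_source_mem_nhds E x,
    (continuousAt_extChartAt (I := 𝓘(ℝ, E)) x).eventually hf',
    (eventually_symm_extChartAt_eq (E := E) (x := x)).eventually_nhds] with y hy hd he
  have h1 : f =ᶠ[𝓝 y] (f ∘ (extChartAt 𝓘(ℝ, E) x).symm) ∘ extChartAt 𝓘(ℝ, E) x := by
    filter_upwards [he] with z hz
    simp only [Function.comp_apply, hz]
  have h2 := ((hd.differentiableAt (by simp)).hasFDerivAt.hasMFDerivAt.comp y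
    (mdifferentiableAt_extChartAt (I := 𝓘(ℝ, E)) hy).hasMFDerivAt).congr_of_eventuallyEq h1
  refine (congrArg (fun L : E →L[ℝ] F' ↦ L (V y)) h2.mfderiv).trans ?_
  exact congrArg (fderiv ℝ (f ∘ (extChartAt 𝓘(ℝ, E) x).symm) (extChartAt 𝓘(ℝ, E) x y))
    (trivializationAt_snd_eq_mfderiv hy (V y)).symm

lemma hasFDerivAt_localRep {x : M} {V : Π y : M, TangentSpace 𝓘(ℝ, E) y} (hV : MDiffAt (T% V) x) :
    HasFDerivAt (localRep x V ∘ (extChartAt 𝓘(ℝ, E) x).symm)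
      (mvfderiv 𝓘(ℝ, E) (localRep x V) x : E →L[ℝ] E) (extChartAt 𝓘(ℝ, E) x x) := by
  have h := mdifferentiableAt_localRep_iff.2 hV
  have h' := mvfderiv_eq_fderiv h
  exact HasFDerivAt.congr_fderiv
    ((mdifferentiableAt_iff_differentiableAt h.continuousAt).1 h).hasFDerivAt h'.symm

/-- The derivative of `df(W)` for a vector field `W` and a vector-valued function `f`. -/
lemma mvfderiv_mvfderiv_apply {f : M → F'} {x : M} (hf : ContMDiffAt 𝓘(ℝ, E) 𝓘(ℝ, F') 2 f x)
    {W : Π y : M, TangentSpace 𝓘(ℝ, E) y} (hW : MDiffAt (T% W) x) (v : TangentSpace 𝓘(ℝ, E) x) :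
    mvfderiv 𝓘(ℝ, E) (fun y ↦ mvfderiv 𝓘(ℝ, E) f y (W y)) x v
      = mvfderiv 𝓘(ℝ, E) f x (mvfderiv 𝓘(ℝ, E) (localRep x W) x v : E)
        + fderiv ℝ (fderiv ℝ (f ∘ (extChartAt 𝓘(ℝ, E) x).symm)) (extChartAt 𝓘(ℝ, E) x x) v
          (W x) := by
  have hf' := contDiffAt_comp_extChartAt_symm (n := 2) hf
  have h1 : HasFDerivAt (fderiv ℝ (f ∘ (extChartAt 𝓘(ℝ, E) x).symm)) _
      (extChartAt 𝓘(ℝ, E) x x) :=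
    ((hf'.fderiv_right (m := 1) (by norm_num)).differentiableAt (by simp)).hasFDerivAt
  have h2 := h1.clm_apply (hasFDerivAt_localRep hW)
  have h3 := hasMFDerivAt_of_eventuallyEq_comp_extChartAt (x := x)
    (g := fun y ↦ mvfderiv 𝓘(ℝ, E) f y (W y)) h2 (by
      filter_upwards [mvfderiv_eventuallyEq_fderiv (hf.of_le (by norm_num)) W,
        eventually_symm_extChartAt_eq (E := E) (x := x)] with y hy hy'
      rw [hy, Function.comp_apply, Function.comp_apply, hy'])
  have h4 : mvfderiv 𝓘(ℝ, E) f x = fderiv ℝ _ _ :=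
    mvfderiv_eq_fderiv (hf.mdifferentiableAt (by simp))
  refine (congrArg (fun L : E →L[ℝ] F' ↦ L v) h3.2).trans ?_
  rw [h4]
  have h5 : (localRep x W ∘ (extChartAt 𝓘(ℝ, E) x).symm) (extChartAt 𝓘(ℝ, E) x x) = W x := by
    rw [Function.comp_apply, extChartAt_to_inv, localRep_self]
  refine Eq.trans ?_ (congrArg (fun w : E ↦ fderiv ℝ (f ∘ (extChartAt 𝓘(ℝ, E) x).symm)
    (extChartAt 𝓘(ℝ, E) x x) (mvfderiv 𝓘(ℝ, E) (localRep x W) x v : E) + fderiv ℝ (fderiv ℝ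
    (f ∘ (extChartAt 𝓘(ℝ, E) x).symm)) (extChartAt 𝓘(ℝ, E) x x) v w) h5)
  rfl

/-- The Lie bracket of vector fields acts on functions as the commutator. -/
lemma mvfderiv_mlieBracket {f : M → F'} {x : M} (hf : ContMDiffAt 𝓘(ℝ, E) 𝓘(ℝ, F') 2 f x)
    {V W : Π y : M, TangentSpace 𝓘(ℝ, E) y} (hV : MDiffAt (T% V) x) (hW : MDiffAt (T% W) x) :
    mvfderiv 𝓘(ℝ, E) f x (mlieBracket 𝓘(ℝ, E) V W x)
      = mvfderiv 𝓘(ℝ, E) (fun y ↦ mvfderiv 𝓘(ℝ, E) f y (W y)) x (V x)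
        - mvfderiv 𝓘(ℝ, E) (fun y ↦ mvfderiv 𝓘(ℝ, E) f y (V y)) x (W x) := by
  have hf' := contDiffAt_comp_extChartAt_symm (n := 2) hf
  have hs := hf'.isSymmSndFDerivAt (by simp)
  rw [mlieBracket_eq_mvfderiv_localRep hV hW, mvfderiv_mvfderiv_apply hf hV,
    mvfderiv_mvfderiv_apply hf hW]
  have h := hs (V x : E) (W x : E)
  rw [h]
  refine (map_sub (mvfderiv 𝓘(ℝ, E) f x) _ _).trans ?_
  abel

variable {E₂ : Type*} [NormedAddCommGroup E₂] [NormedSpace ℝ E₂]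
  {M₂ : Type*} [TopologicalSpace M₂] [ChartedSpace E₂ M₂] [IsManifold 𝓘(ℝ, E₂) ∞ M₂]

omit [IsManifold 𝓘(ℝ, E) ∞ M] [IsManifold 𝓘(ℝ, E₂) ∞ M₂] in
lemma contDiffAt_comp_prod_extChartAt_symm {f : M × M₂ → F'} {x : M} {y : M₂} {n : ℕ}
    (hf : ContMDiffAt (𝓘(ℝ, E).prod 𝓘(ℝ, E₂)) 𝓘(ℝ, F') n f (x, y)) :
    ContDiffAt ℝ n (fun p : E × E₂ ↦
      f ((extChartAt 𝓘(ℝ, E) x).symm p.1, (extChartAt 𝓘(ℝ, E₂) y).symm p.2))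
      (extChartAt 𝓘(ℝ, E) x x, extChartAt 𝓘(ℝ, E₂) y y) := by
  have h1 := (contMDiffAt_iff.1 hf).2
  rw [ModelWithCorners.range_eq_univ, contDiffWithinAt_univ] at h1
  exact h1

/-- The derivative of a partial derivative, computed in a chart. -/
lemma mvfderiv_partial {f : M × M₂ → F'} {x : M} {y : M₂}
    (hf : ContMDiffAt (𝓘(ℝ, E).prod 𝓘(ℝ, E₂)) 𝓘(ℝ, F') 2 f (x, y)) (v : TangentSpace 𝓘(ℝ, E₂) y) :
    MDiffAt (fun a ↦ mvfderiv 𝓘(ℝ, E₂) (fun b ↦ f (a, b)) y v) x ∧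
    ∀ u : TangentSpace 𝓘(ℝ, E) x,
      mvfderiv 𝓘(ℝ, E) (fun a ↦ mvfderiv 𝓘(ℝ, E₂) (fun b ↦ f (a, b)) y v) x u
      = fderiv ℝ (fderiv ℝ (fun p : E × E₂ ↦
      f ((extChartAt 𝓘(ℝ, E) x).symm p.1, (extChartAt 𝓘(ℝ, E₂) y).symm p.2)))
        (extChartAt 𝓘(ℝ, E) x x, extChartAt 𝓘(ℝ, E₂) y y) ((u : E), 0) (0, (v : E₂)) := by
  have hf' := contDiffAt_comp_prod_extChartAt_symm (n := 2) hf
  set F₀ : E × E₂ → F' := fun p ↦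
    f ((extChartAt 𝓘(ℝ, E) x).symm p.1, (extChartAt 𝓘(ℝ, E₂) y).symm p.2) with hF₀
  have h1 : HasFDerivAt (fderiv ℝ F₀) _ (extChartAt 𝓘(ℝ, E) x x, extChartAt 𝓘(ℝ, E₂) y y) :=
    ((hf'.fderiv_right (m := 1) (by norm_num)).differentiableAt (by simp)).hasFDerivAt
  have h2 : HasFDerivAt (fun ξ : E ↦ (ξ, extChartAt 𝓘(ℝ, E₂) y y))
    (ContinuousLinearMap.inl ℝ E E₂) (extChartAt 𝓘(ℝ, E) x x) := hasFDerivAt_prodMk_left _ _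
  have h3 := (h1.comp (extChartAt 𝓘(ℝ, E) x x) h2).clm_apply (hasFDerivAt_const ((0, v) : E × E₂) _)
  have hd : ∀ᶠ a in 𝓝 x, DifferentiableAt ℝ F₀
      (extChartAt 𝓘(ℝ, E) x a, extChartAt 𝓘(ℝ, E₂) y y) := by
    have ht : Filter.Tendsto (fun a : M ↦ (extChartAt 𝓘(ℝ, E) x a, extChartAt 𝓘(ℝ, E₂) y y)) (𝓝 x)
        (𝓝 (extChartAt 𝓘(ℝ, E) x x, extChartAt 𝓘(ℝ, E₂) y y)) :=
      (continuousAt_extChartAt (I := 𝓘(ℝ, E)) x).prodMk continuousAt_const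
    filter_upwards [ht.eventually (hf'.eventually (by simp))] with a ha
    exact ha.differentiableAt (by simp)
  have h4 := hasMFDerivAt_of_eventuallyEq_comp_extChartAt (x := x)
    (g := fun a ↦ mvfderiv 𝓘(ℝ, E₂) (fun b ↦ f (a, b)) y v) h3 (by
      filter_upwards [hd, eventually_symm_extChartAt_eq (E := E) (x := x)] with a ha hs
      have h5 : HasFDerivAt (fun η : E₂ ↦ F₀ (extChartAt 𝓘(ℝ, E) x a, η)) _
        (extChartAt 𝓘(ℝ, E₂) y y) := ha.hasFDerivAt.comp (extChartAt 𝓘(ℝ, E₂) y y)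
          (hasFDerivAt_prodMk_right (𝕜 := ℝ) (extChartAt 𝓘(ℝ, E) x a) (extChartAt 𝓘(ℝ, E₂) y y))
      have h6 := hasMFDerivAt_of_eventuallyEq_comp_extChartAt (x := y)
        (g := fun b ↦ f (a, b)) h5 (by
          filter_upwards [eventually_symm_extChartAt_eq (E := E₂) (x := y)] with b hb
          simp only [hF₀, Function.comp_apply, hs, hb])
      exact congrArg (fun L : E₂ →L[ℝ] F' ↦ L v) h6.2)
  refine ⟨h4.1, fun u ↦ ?_⟩
  refine (congrArg (fun L : E →L[ℝ] F' ↦ L u) h4.2).trans ?_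
  simp
  rfl

/-- Mixed second derivatives on a product of manifolds commute. -/
lemma mvfderiv_mvfderiv_comm {f : M × M₂ → F'} {x : M} {y : M₂}
    (hf : ContMDiffAt (𝓘(ℝ, E).prod 𝓘(ℝ, E₂)) 𝓘(ℝ, F') 2 f (x, y))
    (u : TangentSpace 𝓘(ℝ, E) x) (v : TangentSpace 𝓘(ℝ, E₂) y) :
    mvfderiv 𝓘(ℝ, E) (fun a ↦ mvfderiv 𝓘(ℝ, E₂) (fun b ↦ f (a, b)) y v) x u
      = mvfderiv 𝓘(ℝ, E₂) (fun b ↦ mvfderiv 𝓘(ℝ, E) (fun a ↦ f (a, b)) x u) y v := by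
  have hf' := contDiffAt_comp_prod_extChartAt_symm (n := 2) hf
  have hs := hf'.isSymmSndFDerivAt (by simp)
  have hfs : ContMDiffAt (𝓘(ℝ, E₂).prod 𝓘(ℝ, E)) 𝓘(ℝ, F') 2 (f ∘ Prod.swap) (y, x) :=
    ContMDiffAt.comp (y, x) (g := f) (f := Prod.swap) hf
      (contMDiffAt_snd.prodMk contMDiffAt_fst)
  have h2 := (mvfderiv_partial hfs u).2 v
  rw [(mvfderiv_partial hf v).2]
  refine Eq.trans ?_ h2.symm
  set F₀ : E × E₂ → F' := fun p ↦
    f ((extChartAt 𝓘(ℝ, E) x).symm p.1, (extChartAt 𝓘(ℝ, E₂) y).symm p.2) with hF₀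
  set p := (extChartAt 𝓘(ℝ, E) x x, extChartAt 𝓘(ℝ, E₂) y y)
  let L : (E₂ × E) ≃L[ℝ] (E × E₂) := ContinuousLinearEquiv.prodComm ℝ E₂ E
  have h1 : HasFDerivAt (fderiv ℝ F₀) (fderiv ℝ (fderiv ℝ F₀) p) (L p.swap) :=
    ((hf'.fderiv_right (m := 1) (by norm_num)).differentiableAt (by simp)).hasFDerivAt
  -- The map with the factors exchanged is F₀ composed with the linear swap, so both mixed
  -- derivatives are values of the same second derivative of F₀, which is symmetric.
  have h3 : fderiv ℝ (F₀ ∘ L) = fun q ↦ (fderiv ℝ F₀ (L q)).comp (L : (E₂ × E) →L[ℝ] (E × E₂)) := by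
    ext1 q
    exact L.comp_right_fderiv
  have h4 := (h1.comp p.swap L.hasFDerivAt).clm_comp
    (hasFDerivAt_const (L : (E₂ × E) →L[ℝ] (E × E₂)) p.swap)
  have h5 : fderiv ℝ (fderiv ℝ (F₀ ∘ L)) p.swap ((v : E₂), 0) (0, (u : E))
      = fderiv ℝ (fderiv ℝ F₀) p (0, (v : E₂)) ((u : E), 0) := by
    rw [h3]
    refine (congrArg (fun T : (E₂ × E) →L[ℝ] ((E₂ × E) →L[ℝ] F') ↦ T (v, 0) (0, u))
      h4.fderiv).trans ?_
    simp
    rfl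
  exact (hs ((u : E), 0) (0, (v : E₂))).trans h5.symm

/-- Partial derivatives along a moving curve of parameters and a vector field are differentiable. -/
lemma mdifferentiableAt_partial {f : M × M₂ → F'} {x : M} {y : M₂}
    (hf : ContMDiffAt (𝓘(ℝ, E).prod 𝓘(ℝ, E₂)) 𝓘(ℝ, F') 2 f (x, y)) {s : M₂ → M}
    (hs : MDifferentiableAt 𝓘(ℝ, E₂) 𝓘(ℝ, E) s y) (hsy : s y = x)
    {V : Π b : M₂, TangentSpace 𝓘(ℝ, E₂) b} (hV : MDiffAt (T% V) y) :
    MDiffAt (fun b ↦ mvfderiv 𝓘(ℝ, E₂) (fun b' ↦ f (s b, b')) b (V b)) y := by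
  subst hsy
  have : IsManifold 𝓘(ℝ, E) 1 M := IsManifold.of_le (n := ∞) (by simp)
  have : IsManifold 𝓘(ℝ, E₂) 1 M₂ := IsManifold.of_le (n := ∞) (by simp)
  have hf' := contDiffAt_comp_prod_extChartAt_symm (n := 2) hf
  set F₀ : E × E₂ → F' := fun p ↦
    f ((extChartAt 𝓘(ℝ, E) (s y)).symm p.1, (extChartAt 𝓘(ℝ, E₂) y).symm p.2) with hF₀
  have h1 : DifferentiableAt ℝ (fderiv ℝ F₀)
      (extChartAt 𝓘(ℝ, E) (s y) (s y), extChartAt 𝓘(ℝ, E₂) y y) :=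
    (hf'.fderiv_right (m := 1) (by norm_num)).differentiableAt (by simp)
  have ht : MDifferentiableAt 𝓘(ℝ, E₂) 𝓘(ℝ, E × E₂)
      (fun b ↦ (extChartAt 𝓘(ℝ, E) (s y) (s b), extChartAt 𝓘(ℝ, E₂) y b)) y :=
    ((mdifferentiableAt_extChartAt (mem_chart_source E (s y))).comp y hs).prodMk_space
      (mdifferentiableAt_extChartAt (mem_chart_source E₂ y))
  have h2 : MDiffAt (fun b ↦ fderiv ℝ F₀
      (extChartAt 𝓘(ℝ, E) (s y) (s b), extChartAt 𝓘(ℝ, E₂) y b)) y :=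
    h1.mdifferentiableAt.comp y ht
  have h3 : MDifferentiableAt 𝓘(ℝ, E₂) 𝓘(ℝ, E × E₂) (fun b ↦ ((0, localRep y V b) : E × E₂)) y :=
    mdifferentiableAt_const.prodMk_space (mdifferentiableAt_localRep_iff.2 hV)
  refine (h2.clm_apply h3).congr_of_eventuallyEq ?_
  filter_upwards [ht.continuousAt.eventually (hf'.eventually (by simp)),
    hs.continuousAt.eventually (eventually_symm_extChartAt_eq (E := E) (x := s y)),
    (eventually_symm_extChartAt_eq (E := E₂) (x := y)).eventually_nhds,
    chart_source_mem_nhds E₂ y] with b hb hsb hyb hyc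
  have h5 : HasFDerivAt (fun η : E₂ ↦ F₀ (extChartAt 𝓘(ℝ, E) (s y) (s b), η)) _
      (extChartAt 𝓘(ℝ, E₂) y b) := (hb.differentiableAt (by simp)).hasFDerivAt.comp
        (extChartAt 𝓘(ℝ, E₂) y b) (hasFDerivAt_prodMk_right (𝕜 := ℝ)
          (extChartAt 𝓘(ℝ, E) (s y) (s b)) (extChartAt 𝓘(ℝ, E₂) y b))
  have h6 := (h5.hasMFDerivAt.comp b
    (mdifferentiableAt_extChartAt (I := 𝓘(ℝ, E₂)) hyc).hasMFDerivAt).congr_of_eventuallyEq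
    (f₁ := fun b' ↦ f (s b, b')) (by
      filter_upwards [hyb] with b' hb'
      simp only [hF₀, Function.comp_apply, hsb, hb'])
  refine (congrArg (fun L : E₂ →L[ℝ] F' ↦ L (V b)) h6.mfderiv).trans ?_
  exact congrArg (fun w : E₂ ↦ fderiv ℝ F₀ (extChartAt 𝓘(ℝ, E) (s y) (s b),
    extChartAt 𝓘(ℝ, E₂) y b) ((0 : E), w)) (trivializationAt_snd_eq_mfderiv hyc (V b)).symm

/-- The derivative at `x` of a function with values in the model space, as an endomorphism of the
tangent space at `x`. -/
noncomputable def flatDeriv (x : M) (f : M → E) :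
    TangentSpace 𝓘(ℝ, E) x →L[ℝ] TangentSpace 𝓘(ℝ, E) x := mvfderiv 𝓘(ℝ, E) f x

/-- A representation of vector fields by vector-valued functions which is linear over functions
defines a flat covariant derivative at a point. -/
lemma isCovariantDerivativeOn_flatDeriv {x : M}
    (ρ : (Π y : M, TangentSpace 𝓘(ℝ, E) y) → M → E) (hadd : ∀ V W, ρ (V + W) = ρ V + ρ W)
    (hsmul : ∀ (g : M → ℝ) V, ρ (g • V) = g • ρ V) (hself : ∀ V, ρ V x = V x)
    (hdiff : ∀ V, MDiffAt (T% V) x → MDiffAt (ρ V) x) :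
    IsCovariantDerivativeOn E (V := (TangentSpace 𝓘(ℝ, E) : M → Type _))
      (fun V y ↦ flatDeriv y (ρ V)) {x} where
  add {V W y} hV hW hy := by
    obtain rfl : y = x := hy
    have h := mvfderiv_add (hdiff V hV) (hdiff W hW)
    rw [← hadd] at h
    exact h
  leibniz {V g y} hV hg hy := by
    obtain rfl : y = x := hy
    have h := mvfderiv_smul hg (hdiff V hV)
    rw [← hsmul, hself] at h
    exact h

/-- A covariant derivative and a flat derivative differ at x by a tensor, so the difference sees
only the value of the field at x. D can thus be computed on any convenient field with that value. -/
lemma covariantDerivative_sub_flatDeriv [FiniteDimensional ℝ E] {x : M}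
    (D : CovariantDerivative 𝓘(ℝ, E) E (TangentSpace 𝓘(ℝ, E) : M → Type _))
    (ρ : (Π y : M, TangentSpace 𝓘(ℝ, E) y) → M → E) (hadd : ∀ V W, ρ (V + W) = ρ V + ρ W)
    (hsmul : ∀ (g : M → ℝ) V, ρ (g • V) = g • ρ V) (hself : ∀ V, ρ V x = V x)
    (hdiff : ∀ V, MDiffAt (T% V) x → MDiffAt (ρ V) x)
    {V W : Π y : M, TangentSpace 𝓘(ℝ, E) y} (hV : MDiffAt (T% V) x) (hW : MDiffAt (T% W) x)
    (hVW : V x = W x) :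
    D V x - flatDeriv x (ρ V) = D W x - flatDeriv x (ρ W) := by
  have hρ := isCovariantDerivativeOn_flatDeriv ρ hadd hsmul hself hdiff
  have hD := D.isCovariantDerivativeOn (s := {x})
  have h1 := hD.difference_apply hρ (Set.mem_singleton x) hV
  have h2 := hD.difference_apply hρ (Set.mem_singleton x) hW
  rw [hVW] at h1
  exact h1.symm.trans h2

end LocalRep

/-! ### The action of G in a chart at the origin: translations, action fields and the bracket. -/

section Action

variable {E : Type*} [NormedAddCommGroup E] [NormedSpace ℝ E]
  {F : Type*} [NormedAddCommGroup F] [NormedSpace ℝ F]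
  {G : Type*} [TopologicalSpace G] [ChartedSpace E G] [Group G] [IsTopologicalGroup G]
  [LieGroup 𝓘(ℝ, E) ∞ G] (H : Subgroup G)
  [ChartedSpace F (G ⧸ H)] [IsManifold 𝓘(ℝ, F) ∞ (G ⧸ H)]
  [ContMDiffSMul 𝓘(ℝ, E) 𝓘(ℝ, F) ∞ G (G ⧸ H)]

variable (E F) in
include E in
lemma contMDiff_translation (a : G) :
    ContMDiff 𝓘(ℝ, F) 𝓘(ℝ, F) ∞ (fun x : G ⧸ H ↦ a • x) :=
  (ContMDiffSMul.contMDiff_smul (I := 𝓘(ℝ, E)) (I' := 𝓘(ℝ, F)) (n := ∞) (G := G)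
    (M := G ⧸ H)).comp (contMDiff_const.prodMk contMDiff_id)

variable (E F) in
lemma contMDiff_orbit (x : G ⧸ H) : ContMDiff 𝓘(ℝ, E) 𝓘(ℝ, F) ∞ (fun g : G ↦ g • x) :=
  (ContMDiffSMul.contMDiff_smul (I := 𝓘(ℝ, E)) (I' := 𝓘(ℝ, F)) (n := ∞) (G := G)
    (M := G ⧸ H)).comp (contMDiff_id.prodMk contMDiff_const)

lemma smul_origin (g : G) : g • ((1 : G) : G ⧸ H) = (g : G ⧸ H) :=
  congrArg _ (mul_one g)

lemma projDeriv_one (X : GroupLieAlgebra 𝓘(ℝ, E) G) :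
    actionField (F := F) H X ((1 : G) : G ⧸ H) = projDeriv (F := F) H (1 : G) X := by
  have h : (fun g : G ↦ g • ((1 : G) : G ⧸ H)) = fun g : G ↦ (g : G ⧸ H) :=
    funext (smul_origin H)
  unfold actionField projDeriv
  rw [h]
  rfl

variable (F) in
/-- The action of `G` on `G/H`, read in the preferred chart at the origin. -/
noncomputable def chartAction (p : G × (G ⧸ H)) : F :=
  extChartAt 𝓘(ℝ, F) ((1 : G) : G ⧸ H) (p.1 • p.2)

variable (E F) in
lemma contMDiffAt_chartAction {a : G} {x : G ⧸ H} (h : a • x = ((1 : G) : G ⧸ H)) :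
    ContMDiffAt (𝓘(ℝ, E).prod 𝓘(ℝ, F)) 𝓘(ℝ, F) 2 (chartAction F H) (a, x) := by
  have h1 : ContMDiffAt 𝓘(ℝ, F) 𝓘(ℝ, F) ∞ (extChartAt 𝓘(ℝ, F) ((1 : G) : G ⧸ H)) (a • x) := by
    rw [h]; exact contMDiffAt_extChartAt
  exact (h1.comp (a, x) (ContMDiffSMul.contMDiff_smul (I := 𝓘(ℝ, E)) (I' := 𝓘(ℝ, F)) (n := ∞)
    (G := G) (M := G ⧸ H)).contMDiffAt).of_le (WithTop.coe_le_coe.2 le_top)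

-- Differentials of translations are the partial derivatives of `chartAction` in the point, action
-- fields those in the group element. Viewing both as partials of one map lets commuting mixed
-- derivatives relate them.
variable (E) in
include E in
lemma mvfderiv_chartAction_right {a : G} {x : G ⧸ H}
    (h : a • x ∈ (chartAt F ((1 : G) : G ⧸ H)).source) (v : TangentSpace 𝓘(ℝ, F) x) :
    mvfderiv 𝓘(ℝ, F) (fun y ↦ chartAction F H (a, y)) x v
      = (trivializationAt F (TangentSpace 𝓘(ℝ, F) : G ⧸ H → Type _) ((1 : G) : G ⧸ H)
          ⟨a • x, translDeriv H a x v⟩).2 := by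
  have : IsManifold 𝓘(ℝ, F) 1 (G ⧸ H) := IsManifold.of_le (n := ∞) (by simp)
  have h1 := ((mdifferentiableAt_extChartAt (I := 𝓘(ℝ, F)) h).hasMFDerivAt.comp x
    ((contMDiff_translation E F H a).mdifferentiable (by simp) x).hasMFDerivAt)
  exact (congrArg (fun L : F →L[ℝ] F ↦ L v) h1.mfderiv).trans
    (trivializationAt_snd_eq_mfderiv h _).symm

lemma mvfderiv_chartAction_left {x : G ⧸ H}
    (h : x ∈ (chartAt F ((1 : G) : G ⧸ H)).source) (Y : GroupLieAlgebra 𝓘(ℝ, E) G) :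
    mvfderiv 𝓘(ℝ, E) (fun g ↦ chartAction F H (g, x)) (1 : G) Y
      = localRep ((1 : G) : G ⧸ H) (actionField H Y) x := by
  have : IsManifold 𝓘(ℝ, F) 1 (G ⧸ H) := IsManifold.of_le (n := ∞) (by simp)
  have h' : (1 : G) • x ∈ (chartAt F ((1 : G) : G ⧸ H)).source := by rwa [one_smul]
  have h1 := ((mdifferentiableAt_extChartAt (I := 𝓘(ℝ, F)) h').hasMFDerivAt.comp (1 : G)
    ((contMDiff_orbit E F H x).mdifferentiable (by simp) (1 : G)).hasMFDerivAt)
  refine (congrArg (fun L : E →L[ℝ] F ↦ L Y) h1.mfderiv).trans ?_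
  have h2 : ∀ z : G ⧸ H, z = x → ∀ w : F, mfderiv 𝓘(ℝ, F) 𝓘(ℝ, F)
      (extChartAt 𝓘(ℝ, F) ((1 : G) : G ⧸ H)) z w = (mfderiv 𝓘(ℝ, F) 𝓘(ℝ, F)
      (extChartAt 𝓘(ℝ, F) ((1 : G) : G ⧸ H)) x w : F) := by
    rintro z rfl w; rfl
  exact (h2 _ (one_smul G x) _).trans (trivializationAt_snd_eq_mfderiv h _).symm

/-- The derivative of the translated tangent vector `dτ_g (dπ Y)`, as a function of `g`, is a
derivative along the left-invariant field of `Y`. -/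
lemma mvfderiv_chartAction_eq_mulInvariant (Y : GroupLieAlgebra 𝓘(ℝ, E) G) :
    (fun g : G ↦ mvfderiv 𝓘(ℝ, F) (fun y ↦ chartAction F H (g, y)) ((1 : G) : G ⧸ H)
        (projDeriv (F := F) H (1 : G) Y))
      =ᶠ[𝓝 1] fun g ↦ mvfderiv 𝓘(ℝ, E) (fun g : G ↦ chartAction F H (g, ((1 : G) : G ⧸ H))) g
        (mulInvariantVectorField Y g) := by
  have hcont : ContinuousAt (fun g : G ↦ g • ((1 : G) : G ⧸ H)) 1 :=
    (contMDiff_orbit E F H _).continuous.continuousAt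
  have hev := hcont.eventually (f := fun g : G ↦ g • ((1 : G) : G ⧸ H)) (p := fun y ↦
    y ∈ (chartAt F ((1 : G) : G ⧸ H)).source) (by
      simp only [one_smul]; exact chart_source_mem_nhds F _)
  filter_upwards [hev] with g hg
  have hd : MDifferentiableAt 𝓘(ℝ, F) 𝓘(ℝ, F) (fun y ↦ chartAction F H (g, y))
      ((1 : G) : G ⧸ H) :=
    (mdifferentiableAt_extChartAt (I := 𝓘(ℝ, F)) hg).comp ((1 : G) : G ⧸ H)
      ((contMDiff_translation E F H g).mdifferentiable (by simp) _)
  have hmk : ContMDiff 𝓘(ℝ, E) 𝓘(ℝ, F) ∞ (fun k : G ↦ (k : G ⧸ H)) := by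
    have := contMDiff_orbit E F H ((1 : G) : G ⧸ H)
    simp only [smul_origin] at this
    exact this
  have h1 := hd.hasMFDerivAt.comp (1 : G) (hmk.mdifferentiable (by simp) (1 : G)).hasMFDerivAt
  have hd2 : MDifferentiableAt 𝓘(ℝ, E) 𝓘(ℝ, F)
      (fun k : G ↦ chartAction F H (k, ((1 : G) : G ⧸ H))) (g * 1) := by
    rw [mul_one]
    exact (mdifferentiableAt_extChartAt (I := 𝓘(ℝ, F)) hg).comp g
      ((contMDiff_orbit E F H _).mdifferentiable (by simp) _)
  have h2 := hd2.hasMFDerivAt.comp (1 : G)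
    ((contMDiff_mul_left (I := 𝓘(ℝ, E)) (n := ∞) (a := g)).mdifferentiable (by simp)
      (1 : G)).hasMFDerivAt
  -- Associativity (g k) · o = g · (k · o), differentiated in k at the identity.
  have h3 : (fun k : G ↦ chartAction F H (k, ((1 : G) : G ⧸ H))) ∘ (fun k ↦ g * k)
      = (fun y ↦ chartAction F H (g, y)) ∘ (fun k : G ↦ (k : G ⧸ H)) := by
    funext k
    simp only [Function.comp_apply, chartAction, smul_origin]
    rfl
  rw [h3] at h2
  have h4 : ∀ z : G, z = g → ∀ w : E, mvfderiv 𝓘(ℝ, E)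
      (fun k : G ↦ chartAction F H (k, ((1 : G) : G ⧸ H))) z w = mvfderiv 𝓘(ℝ, E)
      (fun k : G ↦ chartAction F H (k, ((1 : G) : G ⧸ H))) g w := by
    rintro z rfl w; rfl
  exact (congrArg (fun L : E →L[ℝ] F ↦ L Y) (h1.mfderiv.symm.trans h2.mfderiv)).trans
    (h4 _ (mul_one g) _)

lemma mvfderiv_chartAction_one (Z : GroupLieAlgebra 𝓘(ℝ, E) G) :
    mvfderiv 𝓘(ℝ, E) (fun g : G ↦ chartAction F H (g, ((1 : G) : G ⧸ H))) 1 Z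
      = projDeriv (F := F) H (1 : G) Z := by
  rw [mvfderiv_chartAction_left H (mem_chart_source F _), localRep_self, projDeriv_one]

/-- The vector field obtained by translating a tangent vector at the origin by a section `σ` of
the projection. -/
noncomputable def frameField (σ : G ⧸ H → G) (v : TangentSpace 𝓘(ℝ, F) ((1 : G) : G ⧸ H))
    (y : G ⧸ H) : TangentSpace 𝓘(ℝ, F) y :=
  (translDeriv H (σ y) ((1 : G) : G ⧸ H) v : F)

/-- The derivative at the origin of a section of the projection through the identity. -/
noncomputable def originDeriv (σ : G ⧸ H → G) :
    TangentSpace 𝓘(ℝ, F) ((1 : G) : G ⧸ H) →L[ℝ] GroupLieAlgebra 𝓘(ℝ, E) G :=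
  (mfderiv 𝓘(ℝ, F) 𝓘(ℝ, E) σ ((1 : G) : G ⧸ H) : F →L[ℝ] E)

/-- A local section of the projection through the identity, whose derivative at the origin
takes values in `𝔪`. -/
structure IsAdaptedSection (𝔪 : Submodule ℝ (GroupLieAlgebra 𝓘(ℝ, E) G)) (σ : G ⧸ H → G) :
    Prop where
  map_origin : σ ((1 : G) : G ⧸ H) = 1
  smul_eq : ∀ᶠ y in 𝓝 ((1 : G) : G ⧸ H), σ y • ((1 : G) : G ⧸ H) = y
  mdiff : MDifferentiableAt 𝓘(ℝ, F) 𝓘(ℝ, E) σ ((1 : G) : G ⧸ H)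
  originDeriv_mem : ∀ u : TangentSpace 𝓘(ℝ, F) ((1 : G) : G ⧸ H), originDeriv H σ u ∈ 𝔪

lemma mulInvariantVectorField_one (X : GroupLieAlgebra 𝓘(ℝ, E) G) :
    (mulInvariantVectorField X (1 : G) : E) = X := by
  have h : (fun g : G ↦ 1 * g) = id := funext one_mul
  have h2 : mfderiv 𝓘(ℝ, E) 𝓘(ℝ, E) (fun g : G ↦ 1 * g) 1
      = (ContinuousLinearMap.id ℝ E : E →L[ℝ] E) := by
    rw [h]
    exact mfderiv_id
  exact congrArg (fun L : E →L[ℝ] E ↦ L X) h2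

lemma translDeriv_one (x : G ⧸ H) (v : TangentSpace 𝓘(ℝ, F) x) :
    (translDeriv H (1 : G) x v : F) = v := by
  have h : (fun y : G ⧸ H ↦ (1 : G) • y) = id := funext (one_smul G)
  have h2 : mfderiv 𝓘(ℝ, F) 𝓘(ℝ, F) (fun y : G ⧸ H ↦ (1 : G) • y) x
      = (ContinuousLinearMap.id ℝ F : F →L[ℝ] F) := by
    rw [h]
    exact mfderiv_id
  exact congrArg (fun L : F →L[ℝ] F ↦ L v) h2

variable {H} {𝔪 : Submodule ℝ (GroupLieAlgebra 𝓘(ℝ, E) G)} {σ : G ⧸ H → G}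

namespace IsAdaptedSection

variable (hσ : IsAdaptedSection (F := F) H 𝔪 σ)
include hσ

/-- The chain rule for π ∘ σ = id near the origin. Each tangent vector u is thereby represented by
the element `originDeriv H σ u` of 𝔪. -/
lemma projDeriv_originDeriv (u : TangentSpace 𝓘(ℝ, F) ((1 : G) : G ⧸ H)) :
    projDeriv (F := F) H (1 : G) (originDeriv (E := E) H σ u) = u := by
  have hmk : ContMDiff 𝓘(ℝ, E) 𝓘(ℝ, F) ∞ (fun k : G ↦ (k : G ⧸ H)) := by
    have := contMDiff_orbit E F H ((1 : G) : G ⧸ H)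
    simp only [smul_origin] at this
    exact this
  have h1 := (hmk.mdifferentiable (by simp) (σ ((1 : G) : G ⧸ H))).hasMFDerivAt.comp
    ((1 : G) : G ⧸ H) hσ.mdiff.hasMFDerivAt
  have h2 : id =ᶠ[𝓝 ((1 : G) : G ⧸ H)] (fun k : G ↦ (k : G ⧸ H)) ∘ σ := by
    filter_upwards [hσ.smul_eq] with y hy
    rw [Function.comp_apply, ← smul_origin, hy, id]
  have h3 := (h1.congr_of_eventuallyEq h2).mfderiv.symm.trans (mfderiv_id (I := 𝓘(ℝ, F)))
  have h4 : ∀ g : G, g = 1 → ∀ w : E,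
      (mfderiv 𝓘(ℝ, E) 𝓘(ℝ, F) (fun k : G ↦ (k : G ⧸ H)) g w : F)
        = mfderiv 𝓘(ℝ, E) 𝓘(ℝ, F) (fun k : G ↦ (k : G ⧸ H)) 1 w := by
    rintro g rfl w; rfl
  exact (h4 _ hσ.map_origin _).symm.trans (congrArg (fun L : F →L[ℝ] F ↦ L u) h3)

lemma localRep_frameField (v : TangentSpace 𝓘(ℝ, F) ((1 : G) : G ⧸ H)) :
    localRep ((1 : G) : G ⧸ H) (frameField H σ v) =ᶠ[𝓝 ((1 : G) : G ⧸ H)]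
      (fun g : G ↦ mvfderiv 𝓘(ℝ, F) (fun y ↦ chartAction F H (g, y)) ((1 : G) : G ⧸ H) v) ∘ σ := by
  filter_upwards [hσ.smul_eq, chart_source_mem_nhds F ((1 : G) : G ⧸ H)] with y hy hyc
  have h1 := mvfderiv_chartAction_right E H (a := σ y) (x := ((1 : G) : G ⧸ H))
    (by rw [hy]; exact hyc) v
  rw [Function.comp_apply, h1]
  have h2 : ∀ z : G ⧸ H, z = y → ∀ w : F,
      (trivializationAt F (TangentSpace 𝓘(ℝ, F) : G ⧸ H → Type _) ((1 : G) : G ⧸ H) ⟨z, w⟩).2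
        = (trivializationAt F (TangentSpace 𝓘(ℝ, F) : G ⧸ H → Type _)
          ((1 : G) : G ⧸ H) ⟨y, w⟩).2 := by
    rintro z rfl w; rfl
  exact (h2 _ hy _).symm

lemma frameField_origin (v : TangentSpace 𝓘(ℝ, F) ((1 : G) : G ⧸ H)) :
    frameField H σ v ((1 : G) : G ⧸ H) = v := by
  unfold frameField
  rw [hσ.map_origin]
  exact translDeriv_one H _ v

lemma mdifferentiableAt_partial_comp (v : TangentSpace 𝓘(ℝ, F) ((1 : G) : G ⧸ H)) :
    MDiffAt (fun g : G ↦ mvfderiv 𝓘(ℝ, F) (fun y ↦ chartAction F H (g, y)) ((1 : G) : G ⧸ H) v)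
      (σ ((1 : G) : G ⧸ H)) := by
  rw [hσ.map_origin]
  exact (mvfderiv_partial (contMDiffAt_chartAction E F H (one_smul G _)) v).1

lemma mdifferentiableAt_frameField (v : TangentSpace 𝓘(ℝ, F) ((1 : G) : G ⧸ H)) :
    MDiffAt (T% (frameField H σ v)) ((1 : G) : G ⧸ H) :=
  mdifferentiableAt_localRep_iff.1 (((hσ.mdifferentiableAt_partial_comp v).comp _
    hσ.mdiff).congr_of_eventuallyEq (hσ.localRep_frameField v))

lemma flatDeriv_localRep_frameField (u v : TangentSpace 𝓘(ℝ, F) ((1 : G) : G ⧸ H)) :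
    flatDeriv ((1 : G) : G ⧸ H) (localRep ((1 : G) : G ⧸ H) (frameField H σ v)) u
      = mvfderiv 𝓘(ℝ, E) (fun g : G ↦ mvfderiv 𝓘(ℝ, F) (fun y ↦ chartAction F H (g, y))
          ((1 : G) : G ⧸ H) v) 1 (originDeriv H σ u) := by
  have h1 := mvfderiv_congr (E := F) (hσ.localRep_frameField v)
  have h0 := (mvfderiv_partial (contMDiffAt_chartAction E F H (one_smul G _)) v).1
  have h2 := mfderiv_comp_apply_of_eq (I := 𝓘(ℝ, F)) (I' := 𝓘(ℝ, E)) (I'' := 𝓘(ℝ, F))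
    (g := fun g : G ↦
      mvfderiv 𝓘(ℝ, F) (fun y ↦ chartAction F H (g, y)) ((1 : G) : G ⧸ H) v) ((1 : G) : G ⧸ H)
    h0 hσ.mdiff hσ.map_origin u
  exact (congrArg (fun L : F →L[ℝ] F ↦ L u) h1).trans h2

end IsAdaptedSection

variable (E F H) in
lemma mvfderiv_chartAction_left_eventuallyEq (Y : GroupLieAlgebra 𝓘(ℝ, E) G) :
    localRep ((1 : G) : G ⧸ H) (actionField (F := F) H Y) =ᶠ[𝓝 ((1 : G) : G ⧸ H)]
      fun y ↦ mvfderiv 𝓘(ℝ, E) (fun g ↦ chartAction F H (g, y)) (1 : G) Y := by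
  filter_upwards [chart_source_mem_nhds F ((1 : G) : G ⧸ H)] with y hy
  exact (mvfderiv_chartAction_left H hy Y).symm

/-- Commuting the mixed derivatives moves the differentiation from the point to the group, where it
can be compared with the derivative of the frame field. -/
lemma flatDeriv_localRep_actionField (Y : GroupLieAlgebra 𝓘(ℝ, E) G)
    (u : TangentSpace 𝓘(ℝ, F) ((1 : G) : G ⧸ H)) :
    flatDeriv ((1 : G) : G ⧸ H) (localRep ((1 : G) : G ⧸ H) (actionField H Y)) u
      = mvfderiv 𝓘(ℝ, E) (fun g : G ↦ mvfderiv 𝓘(ℝ, F) (fun y ↦ chartAction F H (g, y))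
          ((1 : G) : G ⧸ H) u) 1 Y := by
  have h1 := mvfderiv_congr (E := F) (mvfderiv_chartAction_left_eventuallyEq E F H Y)
  exact (congrArg (fun L : F →L[ℝ] F ↦ L u) h1).trans
    (mvfderiv_mvfderiv_comm (contMDiffAt_chartAction E F H (one_smul G _)) Y u).symm

lemma mdifferentiableAt_actionField (Y : GroupLieAlgebra 𝓘(ℝ, E) G) :
    MDiffAt (T% (actionField (F := F) H Y)) ((1 : G) : G ⧸ H) := by
  refine mdifferentiableAt_localRep_iff.1 (MDifferentiableAt.congr_of_eventuallyEq ?_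
    (mvfderiv_chartAction_left_eventuallyEq E F H Y))
  have hf := contMDiffAt_chartAction E F H (one_smul G ((1 : G) : G ⧸ H))
  have hfs : ContMDiffAt (𝓘(ℝ, F).prod 𝓘(ℝ, E)) 𝓘(ℝ, F) 2 (chartAction F H ∘ Prod.swap)
      (((1 : G) : G ⧸ H), (1 : G)) :=
    ContMDiffAt.comp (((1 : G) : G ⧸ H), (1 : G)) (g := chartAction F H) (f := Prod.swap) hf
      (contMDiffAt_snd.prodMk contMDiffAt_fst)
  exact (mvfderiv_partial hfs Y).1

/-- The flat derivatives of the frame field and the action field of `Y` differ by a bracket. -/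
lemma IsAdaptedSection.flatDeriv_frameField_sub [CompleteSpace E]
    (hσ : IsAdaptedSection (F := F) H 𝔪 σ) (Y : GroupLieAlgebra 𝓘(ℝ, E) G)
    (u : TangentSpace 𝓘(ℝ, F) ((1 : G) : G ⧸ H)) :
    flatDeriv ((1 : G) : G ⧸ H) (localRep ((1 : G) : G ⧸ H)
        (frameField H σ (projDeriv (F := F) H (1 : G) Y))) u
      - flatDeriv ((1 : G) : G ⧸ H) (localRep ((1 : G) : G ⧸ H) (actionField H Y)) u
      = projDeriv (F := F) H (1 : G) ⁅originDeriv (E := E) H σ u, Y⁆ := by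
  have : LieGroup 𝓘(ℝ, E) (minSmoothness ℝ 3) G :=
    LieGroup.of_le (n := ∞) (by simp; exact WithTop.coe_le_coe.2 le_top)
  set X := originDeriv (E := E) H σ u with hX
  have hu : projDeriv (F := F) H (1 : G) X = u := hσ.projDeriv_originDeriv u
  rw [hσ.flatDeriv_localRep_frameField, flatDeriv_localRep_actionField]
  have hf₁ : ContMDiffAt 𝓘(ℝ, E) 𝓘(ℝ, F) 2
      (fun g : G ↦ chartAction F H (g, ((1 : G) : G ⧸ H))) 1 :=
    ContMDiffAt.comp (1 : G) (g := chartAction F H)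
      (contMDiffAt_chartAction E F H (one_smul G ((1 : G) : G ⧸ H)))
      (contMDiffAt_id.prodMk contMDiffAt_const)
  -- For f(g) = φ(g · o) and the left-invariant fields X̃, Ỹ, the frame field contributes X̃(Ỹ f) at
  -- the identity and the action field Ỹ(X̃ f). Their difference is [X̃, Ỹ] f.
  have h1 := mvfderiv_mlieBracket hf₁
    (mdifferentiableAt_mulInvariantVectorField (I := 𝓘(ℝ, E)) X)
    (mdifferentiableAt_mulInvariantVectorField (I := 𝓘(ℝ, E)) Y)
  rw [← mvfderiv_congr (E := E) (mvfderiv_chartAction_eq_mulInvariant H X),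
    ← mvfderiv_congr (E := E) (mvfderiv_chartAction_eq_mulInvariant H Y), hu] at h1
  have h2 := mvfderiv_chartAction_one (F := F) H ⁅X, Y⁆
  have h3 : ∀ L : E →L[ℝ] F, ∀ Z : GroupLieAlgebra 𝓘(ℝ, E) G,
      L (mulInvariantVectorField Z (1 : G) : E) = L Z := fun L Z ↦
    congrArg L (mulInvariantVectorField_one Z)
  exact ((congrArg₂ (fun a b : F ↦ a - b) (h3 _ X) (h3 _ Y)).symm.trans h1.symm).trans h2

end Action

/-! ### The canonical connection as differentiation in a translated frame. -/

section Frame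

variable {E : Type*} [NormedAddCommGroup E] [NormedSpace ℝ E]
  {F : Type*} [NormedAddCommGroup F] [NormedSpace ℝ F]
  {G : Type*} [TopologicalSpace G] [ChartedSpace E G] [Group G] [IsTopologicalGroup G]
  [LieGroup 𝓘(ℝ, E) ∞ G] {H : Subgroup G}
  [ChartedSpace F (G ⧸ H)] [IsManifold 𝓘(ℝ, F) ∞ (G ⧸ H)]
  [ContMDiffSMul 𝓘(ℝ, E) 𝓘(ℝ, F) ∞ G (G ⧸ H)]

variable (E) in
include E in
lemma translDeriv_inv_translDeriv {a : G} {x y : G ⧸ H} (h : a • x = y)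
    (v : TangentSpace 𝓘(ℝ, F) x) :
    (translDeriv H a⁻¹ y (translDeriv H a x v : F) : F) = v := by
  subst h
  have h1 := mfderiv_comp (I := 𝓘(ℝ, F)) (I' := 𝓘(ℝ, F)) (I'' := 𝓘(ℝ, F)) x
    ((contMDiff_translation E F H a⁻¹).mdifferentiable (by simp) (a • x))
    ((contMDiff_translation E F H a).mdifferentiable (by simp) x)
  have h2 : (fun y : G ⧸ H ↦ a⁻¹ • y) ∘ (fun y : G ⧸ H ↦ a • y) = id :=
    funext fun y ↦ inv_smul_smul a y
  rw [h2] at h1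
  exact congrArg (fun L : F →L[ℝ] F ↦ L v) (h1.symm.trans mfderiv_id)

variable (E) in
include E in
lemma translDeriv_translDeriv_inv {a : G} {x y : G ⧸ H} (h : a • x = y)
    (v : TangentSpace 𝓘(ℝ, F) y) :
    (translDeriv H a x (translDeriv H a⁻¹ y v : F) : F) = v := by
  have := translDeriv_inv_translDeriv E (inv_smul_eq_iff.2 h.symm) v
  rwa [inv_inv] at this

/-- The representation of a vector field in the frame given by translating the tangent space at
the origin by a section `σ` of the projection. -/
noncomputable def frameRep (σ : G ⧸ H → G) (V : Π y : G ⧸ H, TangentSpace 𝓘(ℝ, F) y)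
    (y : G ⧸ H) : F := translDeriv H (σ y)⁻¹ y (V y)

lemma frameRep_add (σ : G ⧸ H → G) (V W : Π y : G ⧸ H, TangentSpace 𝓘(ℝ, F) y) :
    frameRep σ (V + W) = frameRep σ V + frameRep σ W :=
  funext fun y ↦ map_add (translDeriv H (σ y)⁻¹ y) (V y) (W y)

lemma frameRep_smul (σ : G ⧸ H → G) (g : G ⧸ H → ℝ) (V : Π y : G ⧸ H, TangentSpace 𝓘(ℝ, F) y) :
    frameRep σ (g • V) = g • frameRep σ V :=
  funext fun y ↦ map_smul (translDeriv H (σ y)⁻¹ y) (g y) (V y)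

variable {𝔪 : Submodule ℝ (GroupLieAlgebra 𝓘(ℝ, E) G)} {σ : G ⧸ H → G}

namespace IsAdaptedSection

variable (hσ : IsAdaptedSection (F := F) H 𝔪 σ)
include hσ

lemma frameRep_origin (V : Π y : G ⧸ H, TangentSpace 𝓘(ℝ, F) y) :
    frameRep σ V ((1 : G) : G ⧸ H) = V ((1 : G) : G ⧸ H) := by
  unfold frameRep
  rw [hσ.map_origin, inv_one]
  exact translDeriv_one H _ _

/-- Near the origin (σ y)⁻¹ carries y to the origin, so the representation is a partial derivative
of `chartAction` along V at the moving pair ((σ y)⁻¹, y), to which `mdifferentiableAt_partial`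
applies. -/
lemma mdifferentiableAt_frameRep (V : Π y : G ⧸ H, TangentSpace 𝓘(ℝ, F) y)
    (hV : MDiffAt (T% V) ((1 : G) : G ⧸ H)) :
    MDiffAt (frameRep σ V) ((1 : G) : G ⧸ H) := by
  have hs : MDifferentiableAt 𝓘(ℝ, F) 𝓘(ℝ, E) (fun y ↦ (σ y)⁻¹) ((1 : G) : G ⧸ H) :=
    ((contMDiff_inv 𝓘(ℝ, E) ∞ (G := G)).mdifferentiable (by simp) _).comp _ hσ.mdiff
  refine (mdifferentiableAt_partial (contMDiffAt_chartAction E F H (one_smul G _)) hs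
    (by simp only [hσ.map_origin, inv_one]) hV).congr_of_eventuallyEq ?_
  filter_upwards [hσ.smul_eq] with y hy
  have hy' : (σ y)⁻¹ • y = ((1 : G) : G ⧸ H) := inv_smul_eq_iff.2 hy.symm
  rw [mvfderiv_chartAction_right E H (by rw [hy']; exact mem_chart_source F _)]
  have h2 : ∀ z : G ⧸ H, z = ((1 : G) : G ⧸ H) → ∀ w : F,
      (trivializationAt F (TangentSpace 𝓘(ℝ, F) : G ⧸ H → Type _) ((1 : G) : G ⧸ H) ⟨z, w⟩).2
        = w := by
    rintro z rfl w
    exact trivializationAt_self_snd _ w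
  exact (h2 _ hy' _).symm

lemma frameRep_frameField (v : TangentSpace 𝓘(ℝ, F) ((1 : G) : G ⧸ H)) :
    frameRep σ (frameField H σ v) =ᶠ[𝓝 ((1 : G) : G ⧸ H)] fun _ ↦ v := by
  filter_upwards [hσ.smul_eq] with y hy
  exact translDeriv_inv_translDeriv E hy v

variable [FiniteDimensional ℝ F] [CompleteSpace E]
  {D₀ : CovariantDerivative 𝓘(ℝ, F) F (TangentSpace 𝓘(ℝ, F) : G ⧸ H → Type _)}
  (hD₀ : IsCanonicalConnection H D₀ 𝔪)
include hD₀

/-- The frame obtained by translating along an adapted section is parallel at the origin for the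
canonical connection. -/
lemma canonical_frameField_eq_zero (v : TangentSpace 𝓘(ℝ, F) ((1 : G) : G ⧸ H)) :
    D₀ (frameField H σ v) ((1 : G) : G ⧸ H) = 0 := by
  ext u
  set Y := originDeriv (E := E) H σ v with hY
  have hv : projDeriv (F := F) H (1 : G) Y = v := hσ.projDeriv_originDeriv v
  set X := originDeriv (E := E) H σ u with hX
  have hu : projDeriv (F := F) H (1 : G) X = u := hσ.projDeriv_originDeriv u
  have h1 := covariantDerivative_sub_flatDeriv D₀ (localRep ((1 : G) : G ⧸ H))
    (x := ((1 : G) : G ⧸ H)) (localRep_add _) (localRep_smul _) (localRep_self _)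
    (fun V hV ↦ mdifferentiableAt_localRep_iff.2 hV)
    (hσ.mdifferentiableAt_frameField v) (mdifferentiableAt_actionField Y)
    ((hσ.frameField_origin v).trans (hv.symm.trans (projDeriv_one H Y).symm))
  have h2 := hσ.flatDeriv_frameField_sub Y u
  have h3 := hD₀.product_eq_zero X (hσ.originDeriv_mem u) Y (hσ.originDeriv_mem v)
  rw [projDeriv_one H X, hu] at h3
  have h4 := congrArg (fun L ↦ L u) h1
  simp only [sub_apply] at h4
  rw [hv] at h2
  -- Replacing the action field by the frame field adds dπ[X, Y], exactly the term that the defining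
  -- equation of the canonical connection requires for a zero sum; this needs X, Y ∈ 𝔪.
  have h5 : D₀ (frameField H σ v) ((1 : G) : G ⧸ H) u
      = D₀ (actionField H Y) ((1 : G) : G ⧸ H) u + projDeriv (F := F) H (1 : G) ⁅X, Y⁆ := by
    rw [← h2, sub_eq_iff_eq_add.1 h4]
    abel
  rw [h5, h3]
  rfl

/-- The canonical connection at the origin is the derivative in an adapted frame. -/
lemma canonical_eq_flatDeriv {V : Π y : G ⧸ H, TangentSpace 𝓘(ℝ, F) y}
    (hV : MDiffAt (T% V) ((1 : G) : G ⧸ H)) :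
    D₀ V ((1 : G) : G ⧸ H) = flatDeriv ((1 : G) : G ⧸ H) (frameRep σ V) := by
  have h1 := covariantDerivative_sub_flatDeriv D₀ (frameRep σ)
    (x := ((1 : G) : G ⧸ H)) (frameRep_add σ) (frameRep_smul σ) hσ.frameRep_origin
    hσ.mdifferentiableAt_frameRep hV (hσ.mdifferentiableAt_frameField (V ((1 : G) : G ⧸ H)))
    (hσ.frameField_origin _).symm
  have h2 : flatDeriv ((1 : G) : G ⧸ H) (frameRep σ (frameField H σ (V ((1 : G) : G ⧸ H)))) = 0 :=
    (mvfderiv_congr (E := F) (hσ.frameRep_frameField _)).trans (mvfderiv_const _)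
  rw [hσ.canonical_frameField_eq_zero hD₀, h2, sub_zero, sub_eq_zero] at h1
  exact h1

end IsAdaptedSection

end Frame

/-! ### Existence of an adapted section. -/

section AdaptedSection

variable {E : Type*} [NormedAddCommGroup E] [NormedSpace ℝ E]
  {F : Type*} [NormedAddCommGroup F] [NormedSpace ℝ F]
  {G : Type*} [TopologicalSpace G] [ChartedSpace E G] [Group G] [IsTopologicalGroup G]
  [LieGroup 𝓘(ℝ, E) ∞ G] {H : Subgroup G}
  [ChartedSpace F (G ⧸ H)] [IsManifold 𝓘(ℝ, F) ∞ (G ⧸ H)]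
  [ContMDiffSMul 𝓘(ℝ, E) 𝓘(ℝ, F) ∞ G (G ⧸ H)]
  {𝔪 : Submodule ℝ (GroupLieAlgebra 𝓘(ℝ, E) G)}

/-- A linear section of `dπ_e` with values in `𝔪`. -/
lemma IsReductiveDecomposition.exists_linear_section [FiniteDimensional ℝ F]
    (h𝔪 : IsReductiveDecomposition (F := F) H 𝔪)
    (hπ : Function.Surjective (projDeriv (E := E) (F := F) H (1 : G))) :
    ∃ ι : F →L[ℝ] E, (∀ u, (projDeriv (F := F) H (1 : G) (ι u) : F) = u) ∧
      ∀ u, (ι u : GroupLieAlgebra 𝓘(ℝ, E) G) ∈ 𝔪 := by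
  let L : 𝔪 →ₗ[ℝ] F := (projDeriv (F := F) H (1 : G)).toLinearMap ∘ₗ 𝔪.subtype
  -- The kernel of dπ is a complement of 𝔪, so dπ stays surjective on 𝔪.
  have hL : L.range = ⊤ := by
    rw [LinearMap.range_eq_top]
    intro w
    obtain ⟨X, hX⟩ := hπ w
    obtain ⟨a, ha, b, hb, hab⟩ := Submodule.mem_sup.1
      (h𝔪.isCompl.sup_eq_top ▸ Submodule.mem_top : X ∈ isotropyAlgebra (F := F) H ⊔ 𝔪)
    refine ⟨⟨b, hb⟩, ?_⟩
    have ha' : projDeriv (F := F) H (1 : G) a = 0 := ha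
    have h1 := map_add (projDeriv (F := F) H (1 : G)) a b
    rw [hab, ha', zero_add, hX] at h1
    exact h1.symm
  obtain ⟨g, hg⟩ := L.exists_rightInverse_of_surjective hL
  refine ⟨LinearMap.toContinuousLinearMap (𝔪.subtype ∘ₗ g : F →ₗ[ℝ] E), fun u ↦ ?_, fun u ↦ ?_⟩
  · exact congrArg (fun T : F →ₗ[ℝ] F ↦ T u) hg
  · exact (g u).2

/-- In charts, p ↦ (ψ⁻¹(ψ 1 + ι p)) · o has derivative dπ ∘ ι = id at 0. Its local inverse k from
the inverse function theorem gives σ = ψ⁻¹(ψ 1 + ι(k(φ y))), whose derivative at the origin is ι,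
with values in 𝔪. -/
lemma IsReductiveDecomposition.exists_isAdaptedSection [FiniteDimensional ℝ F]
    (h𝔪 : IsReductiveDecomposition (F := F) H 𝔪)
    (hπ : Function.Surjective (projDeriv (E := E) (F := F) H (1 : G))) :
    ∃ σ : G ⧸ H → G, IsAdaptedSection (F := F) H 𝔪 σ := by
  obtain ⟨ι, hι, hιm⟩ := h𝔪.exists_linear_section hπ
  have : CompleteSpace F := FiniteDimensional.complete ℝ F
  have : IsManifold 𝓘(ℝ, E) 1 G := IsManifold.of_le (n := ∞) (by simp)
  have : IsManifold 𝓘(ℝ, F) 1 (G ⧸ H) := IsManifold.of_le (n := ∞) (by simp)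
  set o := ((1 : G) : G ⧸ H) with ho
  set ψ := extChartAt 𝓘(ℝ, E) (1 : G) with hψ
  set φ := extChartAt 𝓘(ℝ, F) o with hφ
  have hf₁ : ContMDiffAt 𝓘(ℝ, E) 𝓘(ℝ, F) 2 (fun g : G ↦ chartAction F H (g, o)) 1 :=
    ContMDiffAt.comp (1 : G) (g := chartAction F H)
      (contMDiffAt_chartAction E F H (one_smul G o)) (contMDiffAt_id.prodMk contMDiffAt_const)
  have hfc := (contDiffAt_comp_extChartAt_symm (n := 2) hf₁).hasStrictFDerivAt (by simp)
  rw [← mvfderiv_eq_fderiv (hf₁.mdifferentiableAt (by simp)), ← hψ] at hfc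
  have hj : HasStrictFDerivAt (fun p : F ↦ ψ 1 + ι p) ι 0 := ι.hasStrictFDerivAt.const_add _
  have hj0 : ψ 1 + ι 0 = ψ 1 := by simp
  set h : F → F := fun p ↦ chartAction F H (ψ.symm (ψ 1 + ι p), o) with hh
  have hstrict : HasStrictFDerivAt h ((ContinuousLinearEquiv.refl ℝ F : F ≃L[ℝ] F) : F →L[ℝ] F)
      0 := by
    have h1 : HasStrictFDerivAt h ((mvfderiv 𝓘(ℝ, E) (fun g : G ↦ chartAction F H (g, o)) 1 :
        E →L[ℝ] F) ∘L ι) 0 := by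
      refine HasStrictFDerivAt.comp (g := fun ξ ↦ chartAction F H (ψ.symm ξ, o)) 0 ?_ hj
      rw [hj0]
      exact hfc
    refine h1.congr_fderiv ?_
    ext u
    exact (mvfderiv_chartAction_one H _).trans (hι u)
  have h0 : h 0 = φ o := by
    have h1 : ψ.symm (ψ 1) • o = o := by rw [hψ, extChartAt_to_inv, one_smul]
    exact (congrArg (fun ξ ↦ chartAction F H (ψ.symm ξ, o)) hj0).trans (congrArg φ h1)
  set k := hstrict.localInverse h _ 0 with hk
  have hkd : HasStrictFDerivAt k (ContinuousLinearMap.id ℝ F) (φ o) := by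
    have := hstrict.to_localInverse
    rw [h0] at this
    exact this
  have hk0 : k (φ o) = 0 := by
    rw [← h0]; exact hstrict.localInverse_apply_image
  have hkr : ∀ᶠ η in 𝓝 (φ o), h (k η) = η := by
    rw [← h0]; exact hstrict.eventually_right_inverse
  have hφd : HasMFDerivAt 𝓘(ℝ, F) 𝓘(ℝ, F) φ o (ContinuousLinearMap.id ℝ F : F →L[ℝ] F) := by
    have h1 := (mdifferentiableAt_extChartAt (I := 𝓘(ℝ, F)) (mem_chart_source F o)).hasMFDerivAt
    have h2 : mfderiv 𝓘(ℝ, F) 𝓘(ℝ, F) (extChartAt 𝓘(ℝ, F) o) o = ContinuousLinearMap.id ℝ F :=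
      mfderiv_extChartAt_self
    exact h1.congr_mfderiv h2
  have hψd : HasMFDerivAt 𝓘(ℝ, E) 𝓘(ℝ, E) ψ.symm (ψ 1)
      (ContinuousLinearMap.id ℝ E : E →L[ℝ] E) := by
    have h1 := (mdifferentiableWithinAt_extChartAt_symm (I := 𝓘(ℝ, E))
      (mem_extChartAt_target (1 : G))).hasMFDerivWithinAt
    have h2 := mfderivWithin_range_extChartAt_symm (I := 𝓘(ℝ, E)) (x := (1 : G))
    rw [ModelWithCorners.range_eq_univ] at h1 h2
    rw [hasMFDerivWithinAt_univ] at h1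
    exact h1.congr_mfderiv h2
  have hin : HasFDerivAt (fun η : F ↦ ψ 1 + ι (k η)) (ι ∘L ContinuousLinearMap.id ℝ F) (φ o) :=
    (ι.hasFDerivAt.comp _ hkd.hasFDerivAt).const_add _
  have hσd : HasMFDerivAt 𝓘(ℝ, F) 𝓘(ℝ, E) (fun y ↦ ψ.symm (ψ 1 + ι (k (φ y)))) o
      (ι : F →L[ℝ] E) := by
    have h1 := hin.hasMFDerivAt.comp o hφd
    refine HasMFDerivAt.comp (g := ψ.symm) (f := fun y ↦ ψ 1 + ι (k (φ y)))
      (g' := (ContinuousLinearMap.id ℝ E : E →L[ℝ] E)) o ?_ h1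
    rw [hk0, hj0]
    exact hψd
  have hσ0 : ψ.symm (ψ 1 + ι (k (φ o))) = 1 := by
    rw [hk0, hj0, hψ, extChartAt_to_inv]
  refine ⟨fun y ↦ ψ.symm (ψ 1 + ι (k (φ y))), hσ0, ?_, hσd.mdifferentiableAt, fun u ↦ ?_⟩
  · have hc : ContinuousAt (fun y ↦ ψ.symm (ψ 1 + ι (k (φ y))) • o) o :=
      (contMDiff_orbit E F H o).continuous.continuousAt.comp hσd.continuousAt
    have hs : ∀ᶠ y in 𝓝 o, ψ.symm (ψ 1 + ι (k (φ y))) • o ∈ φ.source := by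
      refine hc.eventually (p := fun z ↦ z ∈ φ.source) ?_
      beta_reduce
      rw [hσ0, one_smul]
      exact extChartAt_source_mem_nhds o
    filter_upwards [hs, extChartAt_source_mem_nhds (I := 𝓘(ℝ, F)) o,
      (continuousAt_extChartAt (I := 𝓘(ℝ, F)) o).eventually hkr] with y hy hy' hkry
    exact φ.injOn hy hy' hkry
  · have h1 := hσd.mfderiv
    have h2 : originDeriv (E := E) H (fun y ↦ ψ.symm (ψ 1 + ι (k (φ y)))) u = ι u :=
      congrArg (fun T : F →L[ℝ] E ↦ T u) h1
    rw [h2]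
    exact hιm u

end AdaptedSection

/-! ### The product rule for a constant bilinear map. -/

section Bilinear

variable {E : Type*} [NormedAddCommGroup E] [NormedSpace ℝ E]
  {M : Type*} [TopologicalSpace M] [ChartedSpace E M] [IsManifold 𝓘(ℝ, E) ∞ M]
  {V₁ V₂ W : Type*} [NormedAddCommGroup V₁] [NormedSpace ℝ V₁]
  [NormedAddCommGroup V₂] [NormedSpace ℝ V₂] [NormedAddCommGroup W] [NormedSpace ℝ W]

lemma mvfderiv_bilinear (T : V₁ →L[ℝ] V₂ →L[ℝ] W) {f : M → V₁} {g : M → V₂} {x : M}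
    (hf : MDiffAt f x) (hg : MDiffAt g x) (u : TangentSpace 𝓘(ℝ, E) x) :
    mvfderiv 𝓘(ℝ, E) (fun y ↦ T (f y) (g y)) x u
      = T (mvfderiv 𝓘(ℝ, E) f x u) (g x) + T (f x) (mvfderiv 𝓘(ℝ, E) g x u) := by
  have hf' := ((mdifferentiableAt_iff_differentiableAt hf.continuousAt).1 hf).hasFDerivAt
  have hg' := ((mdifferentiableAt_iff_differentiableAt hg.continuousAt).1 hg).hasFDerivAt
  rw [← mvfderiv_eq_fderiv hf] at hf'
  rw [← mvfderiv_eq_fderiv hg] at hg'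
  have h := hasMFDerivAt_of_eventuallyEq_comp_extChartAt (x := x) (g := fun y ↦ T (f y) (g y))
    (T.hasFDerivAt_of_bilinear hf' hg') (by
      filter_upwards [eventually_symm_extChartAt_eq (E := E) (x := x)] with y hy
      simp only [Function.comp_apply, hy])
  refine (congrArg (fun L : E →L[ℝ] W ↦ L u) h.2).trans ?_
  simp only [Function.comp_apply, extChartAt_to_inv, ContinuousLinearMap.precompR_apply]
  exact add_comm _ _

end Bilinear

/-! ### Invariant tensors are parallel at the origin for the canonical connection. -/

section Invariant

variable {E : Type*} [NormedAddCommGroup E] [NormedSpace ℝ E] [CompleteSpace E]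
  {F : Type*} [NormedAddCommGroup F] [NormedSpace ℝ F] [FiniteDimensional ℝ F]
  {G : Type*} [TopologicalSpace G] [ChartedSpace E G] [Group G] [IsTopologicalGroup G]
  [LieGroup 𝓘(ℝ, E) ∞ G] {H : Subgroup G}
  [ChartedSpace F (G ⧸ H)] [IsManifold 𝓘(ℝ, F) ∞ (G ⧸ H)]
  [ContMDiffSMul 𝓘(ℝ, E) 𝓘(ℝ, F) ∞ G (G ⧸ H)]
  {𝔪 : Submodule ℝ (GroupLieAlgebra 𝓘(ℝ, E) G)} {σ : G ⧸ H → G}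
  {D₀ : CovariantDerivative 𝓘(ℝ, F) F (TangentSpace 𝓘(ℝ, F) : G ⧸ H → Type _)}

namespace IsAdaptedSection

variable (hσ : IsAdaptedSection (F := F) H 𝔪 σ) (hD₀ : IsCanonicalConnection H D₀ 𝔪)
include hσ hD₀

/-- A bilinear expression with constant coefficients in the adapted frame is differentiated at the
origin by the Leibniz rule for the canonical connection. -/
lemma mvfderiv_bilinear_frameRep {W : Type*} [NormedAddCommGroup W] [NormedSpace ℝ W]
    (T : F →L[ℝ] F →L[ℝ] W) {Y Z : Π y : G ⧸ H, TangentSpace 𝓘(ℝ, F) y}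
    (hY : MDiffAt (T% Y) ((1 : G) : G ⧸ H)) (hZ : MDiffAt (T% Z) ((1 : G) : G ⧸ H))
    {f : G ⧸ H → W}
    (hf : f =ᶠ[𝓝 ((1 : G) : G ⧸ H)] fun y ↦ T (frameRep σ Y y) (frameRep σ Z y))
    (u : TangentSpace 𝓘(ℝ, F) ((1 : G) : G ⧸ H)) :
    mvfderiv 𝓘(ℝ, F) f ((1 : G) : G ⧸ H) u
      = T (D₀ Y ((1 : G) : G ⧸ H) u : F) (Z ((1 : G) : G ⧸ H) : F)
        + T (Y ((1 : G) : G ⧸ H) : F) (D₀ Z ((1 : G) : G ⧸ H) u : F) := by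
  rw [mvfderiv_congr hf, mvfderiv_bilinear T (hσ.mdifferentiableAt_frameRep Y hY)
    (hσ.mdifferentiableAt_frameRep Z hZ), hσ.canonical_eq_flatDeriv hD₀ hY,
    hσ.canonical_eq_flatDeriv hD₀ hZ, hσ.frameRep_origin Y, hσ.frameRep_origin Z]
  rfl

/-- Invariant bilinear forms are parallel at the origin for the canonical connection. -/
lemma mvfderiv_invariant {B : Π y : G ⧸ H, TangentSpace 𝓘(ℝ, F) y →
      TangentSpace 𝓘(ℝ, F) y → ℝ}
    (hB : ∀ (a : G) (y : G ⧸ H) (v w : TangentSpace 𝓘(ℝ, F) y),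
      B (a • y) (translDeriv H a y v) (translDeriv H a y w) = B y v w)
    (T : F →L[ℝ] F →L[ℝ] ℝ)
    (hT : ∀ v w : TangentSpace 𝓘(ℝ, F) ((1 : G) : G ⧸ H), B ((1 : G) : G ⧸ H) v w = T v w)
    {Y Z : Π y : G ⧸ H, TangentSpace 𝓘(ℝ, F) y}
    (hY : MDiffAt (T% Y) ((1 : G) : G ⧸ H)) (hZ : MDiffAt (T% Z) ((1 : G) : G ⧸ H))
    (u : TangentSpace 𝓘(ℝ, F) ((1 : G) : G ⧸ H)) :
    mvfderiv 𝓘(ℝ, F) (fun y ↦ B y (Y y) (Z y)) ((1 : G) : G ⧸ H) u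
      = B _ (D₀ Y ((1 : G) : G ⧸ H) u) (Z ((1 : G) : G ⧸ H))
        + B _ (Y ((1 : G) : G ⧸ H)) (D₀ Z ((1 : G) : G ⧸ H) u) := by
  rw [hT, hT]
  refine hσ.mvfderiv_bilinear_frameRep hD₀ T hY hZ ?_ u
  filter_upwards [hσ.smul_eq] with y hy
  have hy' : (σ y)⁻¹ • y = ((1 : G) : G ⧸ H) := inv_smul_eq_iff.2 hy.symm
  -- Translating back by (σ y)⁻¹ turns the invariant form at y into the fixed form T applied to the
  -- frame representations: its coefficients in the frame are constant.
  have h2 : ∀ z : G ⧸ H, z = ((1 : G) : G ⧸ H) → ∀ v w : F, B z v w = T v w := by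
    rintro z rfl v w
    exact hT v w
  exact (hB (σ y)⁻¹ y (Y y) (Z y)).symm.trans (h2 _ hy' _ _)

/-- Invariant bilinear products are parallel at the origin for the canonical connection. -/
lemma canonical_invariant_product {S : Π y : G ⧸ H, TangentSpace 𝓘(ℝ, F) y →L[ℝ]
      TangentSpace 𝓘(ℝ, F) y →L[ℝ] TangentSpace 𝓘(ℝ, F) y}
    (hS : ∀ (a : G) (y : G ⧸ H) (v w : TangentSpace 𝓘(ℝ, F) y),
      S (a • y) (translDeriv H a y v) (translDeriv H a y w) = translDeriv H a y (S y v w))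
    {Y Z : Π y : G ⧸ H, TangentSpace 𝓘(ℝ, F) y}
    (hY : MDiffAt (T% Y) ((1 : G) : G ⧸ H)) (hZ : MDiffAt (T% Z) ((1 : G) : G ⧸ H))
    (hSYZ : MDiffAt (T% (fun y ↦ S y (Y y) (Z y))) ((1 : G) : G ⧸ H))
    (u : TangentSpace 𝓘(ℝ, F) ((1 : G) : G ⧸ H)) :
    D₀ (fun y ↦ S y (Y y) (Z y)) ((1 : G) : G ⧸ H) u
      = S _ (D₀ Y ((1 : G) : G ⧸ H) u) (Z ((1 : G) : G ⧸ H))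
        + S _ (Y ((1 : G) : G ⧸ H)) (D₀ Z ((1 : G) : G ⧸ H) u) := by
  rw [hσ.canonical_eq_flatDeriv hD₀ hSYZ]
  let T : F →L[ℝ] F →L[ℝ] F := S ((1 : G) : G ⧸ H)
  refine hσ.mvfderiv_bilinear_frameRep (W := F) hD₀ T hY hZ
    (f := frameRep σ fun y ↦ S y (Y y) (Z y)) ?_ u
  filter_upwards [hσ.smul_eq] with y hy
  have hy' : (σ y)⁻¹ • y = ((1 : G) : G ⧸ H) := inv_smul_eq_iff.2 hy.symm
  have h2 : ∀ z : G ⧸ H, z = ((1 : G) : G ⧸ H) → ∀ v w : F,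
      (S z v w : F) = S ((1 : G) : G ⧸ H) v w := by
    rintro z rfl v w
    rfl
  exact (hS (σ y)⁻¹ y (Y y) (Z y)).symm.trans (h2 _ hy' _ _)

end IsAdaptedSection

end Invariant

/-! ### Push-forward of vector fields under translations. -/

section PushForward

variable {E : Type*} [NormedAddCommGroup E] [NormedSpace ℝ E]
  {F : Type*} [NormedAddCommGroup F] [NormedSpace ℝ F]
  {G : Type*} [TopologicalSpace G] [ChartedSpace E G] [Group G] [IsTopologicalGroup G]
  [LieGroup 𝓘(ℝ, E) ∞ G] {H : Subgroup G}
  [ChartedSpace F (G ⧸ H)] [IsManifold 𝓘(ℝ, F) ∞ (G ⧸ H)]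
  [ContMDiffSMul 𝓘(ℝ, E) 𝓘(ℝ, F) ∞ G (G ⧸ H)]

/-- The push-forward of a vector field on `G/H` under a left translation. -/
noncomputable def pushField (a : G) (W : Π x : G ⧸ H, TangentSpace 𝓘(ℝ, F) x) (x : G ⧸ H) :
    TangentSpace 𝓘(ℝ, F) x := (translDeriv H a (a⁻¹ • x) (W (a⁻¹ • x)) : F)

lemma pushField_smul (a : G) (W : Π x : G ⧸ H, TangentSpace 𝓘(ℝ, F) x) (x : G ⧸ H) :
    pushField a W (a • x) = translDeriv H a x (W x) := by
  have h : ∀ z : G ⧸ H, z = x → (translDeriv H a z (W z) : F) = translDeriv H a x (W x) := by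
    rintro z rfl; rfl
  exact h _ (inv_smul_smul a x)

variable (E) in
include E in
lemma isSmoothField_pushField (a : G) {W : Π x : G ⧸ H, TangentSpace 𝓘(ℝ, F) x}
    (hW : IsSmoothField W) : IsSmoothField (pushField a W) := by
  have : IsManifold 𝓘(ℝ, F) 1 (G ⧸ H) := IsManifold.of_le (n := ∞) (by simp)
  have h1 := (ContMDiff.contMDiff_tangentMap (contMDiff_translation E F H a) (m := ∞)
    (by simp)).comp (hW.comp (contMDiff_translation E F H a⁻¹))
  have h2 : ∀ z x : G ⧸ H, z = x → ∀ w : F,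
      (⟨z, w⟩ : TangentBundle 𝓘(ℝ, F) (G ⧸ H)) = ⟨x, w⟩ := by
    rintro z x rfl w; rfl
  have h3 : (fun x ↦ (⟨x, pushField a W x⟩ : TangentBundle 𝓘(ℝ, F) (G ⧸ H)))
      = tangentMap 𝓘(ℝ, F) 𝓘(ℝ, F) (fun y : G ⧸ H ↦ a • y) ∘
        (fun x ↦ (⟨x, W x⟩ : TangentBundle 𝓘(ℝ, F) (G ⧸ H))) ∘ (fun x ↦ a⁻¹ • x) :=
    funext fun x ↦ h2 _ _ (smul_inv_smul a x).symm _
  unfold IsSmoothField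
  rw [h3]
  exact h1

variable (E) in
include E in
lemma translDeriv_surjective (a : G) (x : G ⧸ H) :
    Function.Surjective (translDeriv (F := F) H a x) := fun v ↦
  ⟨(translDeriv H a⁻¹ (a • x) v : F), translDeriv_translDeriv_inv E rfl v⟩

variable (E) in
include E in
lemma translDeriv_mlieBracket [CompleteSpace F] (a : G)
    {V W : Π x : G ⧸ H, TangentSpace 𝓘(ℝ, F) x} (hV : IsSmoothField V) (hW : IsSmoothField W)
    (x : G ⧸ H) :
    mlieBracket 𝓘(ℝ, F) (pushField a V) (pushField a W) (a • x)
      = translDeriv H a x (mlieBracket 𝓘(ℝ, F) V W x) := by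
  have : IsManifold 𝓘(ℝ, F) (minSmoothness ℝ 2) (G ⧸ H) := IsManifold.of_le (n := ∞)
    (by simp; exact WithTop.coe_le_coe.2 le_top)
  have h0 := mpullback_mlieBracket (x₀ := x) (n := ∞) (f := fun y : G ⧸ H ↦ a • y)
    ((isSmoothField_pushField E a hV).mdifferentiable (by simp) (a • x))
    ((isSmoothField_pushField E a hW).mdifferentiable (by simp) (a • x))
    (contMDiff_translation E F H a).contMDiffAt (by simp; exact WithTop.coe_le_coe.2 le_top)
  have hinv : ∀ (y : G ⧸ H) (v : TangentSpace 𝓘(ℝ, F) y),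
      (mfderiv 𝓘(ℝ, F) 𝓘(ℝ, F) (fun y : G ⧸ H ↦ a • y) y).inverse (translDeriv H a y v) = v := by
    intro y v
    have h1 := ContinuousLinearMap.inverse_eq (f := translDeriv (F := F) H a y)
      (g := (translDeriv H a⁻¹ (a • y) : F →L[ℝ] F))
      (ContinuousLinearMap.ext fun w ↦ translDeriv_translDeriv_inv E rfl w)
      (ContinuousLinearMap.ext fun w ↦ translDeriv_inv_translDeriv E rfl w)
    exact (congrArg (fun L : F →L[ℝ] F ↦ L (translDeriv H a y v)) h1).trans
      (translDeriv_inv_translDeriv E rfl v)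
  have hpull : ∀ U : Π x : G ⧸ H, TangentSpace 𝓘(ℝ, F) x,
      mpullback 𝓘(ℝ, F) 𝓘(ℝ, F) (fun y : G ⧸ H ↦ a • y) (pushField a U) = U := by
    intro U
    funext y
    rw [mpullback_apply, pushField_smul]
    exact hinv y _
  rw [hpull, hpull] at h0
  obtain ⟨w, hw⟩ := translDeriv_surjective E a x
    (mlieBracket 𝓘(ℝ, F) (pushField a V) (pushField a W) (a • x))
  rw [mpullback_apply, ← hw] at h0
  rw [← hw, ← h0]
  exact congrArg _ (hinv x w).symm

end PushForward

/-! ### The difference tensor of two connections and its relation to torsion. -/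

section Difference

variable {F : Type*} [NormedAddCommGroup F] [NormedSpace ℝ F] [FiniteDimensional ℝ F]
  {M : Type*} [TopologicalSpace M] [ChartedSpace F M] [IsManifold 𝓘(ℝ, F) ∞ M]
  (D D₀ : CovariantDerivative 𝓘(ℝ, F) F (TangentSpace 𝓘(ℝ, F) : M → Type _))

lemma difference_apply {x : M} {Z : Π y : M, TangentSpace 𝓘(ℝ, F) y} (hZ : MDiffAt (T% Z) x)
    (u : TangentSpace 𝓘(ℝ, F) x) :
    D.difference D₀ x (Z x) u = D Z x u - D₀ Z x u :=
  congrArg (fun L : TangentSpace 𝓘(ℝ, F) x →L[ℝ] TangentSpace 𝓘(ℝ, F) x ↦ L u)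
    (D.isCovariantDerivativeOnUniv.difference_apply D₀.isCovariantDerivativeOnUniv
      (Set.mem_univ x) hZ)

lemma difference_smoothExtend [T2Space M] {x : M} (v u : TangentSpace 𝓘(ℝ, F) x) :
    D.difference D₀ x v u = D (smoothExtend v) x u - D₀ (smoothExtend v) x u := by
  rw [← difference_apply D D₀ ((isSmoothField_smoothExtend v).mdifferentiable (by simp) x),
    smoothExtend_self]

variable {D D₀}

lemma covariant_sub_eq_mlieBracket [CompleteSpace F] (hD : D.torsion = 0) {x : M}
    {X Y : Π y : M, TangentSpace 𝓘(ℝ, F) y} (hX : MDiffAt (T% X) x) (hY : MDiffAt (T% Y) x) :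
    mlieBracket 𝓘(ℝ, F) X Y x = D Y x (X x) - D X x (Y x) := by
  have h := D.torsion_apply hX hY
  rw [hD] at h
  exact (sub_eq_zero.1 h.symm).symm

/-- As D is torsion-free, the alternating part of the difference tensor depends on D₀ only; the
invariance of D₀ will therefore pass to it. -/
lemma difference_sub_difference [T2Space M] [CompleteSpace F] (hD : D.torsion = 0) {x : M}
    (u v : TangentSpace 𝓘(ℝ, F) x) :
    D.difference D₀ x v u - D.difference D₀ x u v = - D₀.torsion x u v := by
  have hu := (isSmoothField_smoothExtend u).mdifferentiable (by simp) x
  have hv := (isSmoothField_smoothExtend v).mdifferentiable (by simp) x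
  have h0 := D₀.torsion_apply hu hv
  rw [covariant_sub_eq_mlieBracket hD hu hv] at h0
  simp only [smoothExtend_self] at h0
  rw [h0, difference_smoothExtend, difference_smoothExtend]
  abel

end Difference

/-! ### Skewness and invariance of the difference tensor. -/

section Invariance

variable {E : Type*} [NormedAddCommGroup E] [NormedSpace ℝ E] [CompleteSpace E]
  {F : Type*} [NormedAddCommGroup F] [NormedSpace ℝ F] [FiniteDimensional ℝ F] [CompleteSpace F]
  {G : Type*} [TopologicalSpace G] [ChartedSpace E G] [Group G] [IsTopologicalGroup G]
  [LieGroup 𝓘(ℝ, E) ∞ G] {H : Subgroup G}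
  [ChartedSpace F (G ⧸ H)] [IsManifold 𝓘(ℝ, F) ∞ (G ⧸ H)]
  [ContMDiffSMul 𝓘(ℝ, E) 𝓘(ℝ, F) ∞ G (G ⧸ H)] [T2Space (G ⧸ H)]
  {𝔪 : Submodule ℝ (GroupLieAlgebra 𝓘(ℝ, E) G)} {σ : G ⧸ H → G}
  {D D₀ : CovariantDerivative 𝓘(ℝ, F) F (TangentSpace 𝓘(ℝ, F) : G ⧸ H → Type _)}

variable (E) in
include E in
lemma IsInvariantConnection.torsion_translDeriv (hD₀ : IsInvariantConnection H D₀) (a : G)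
    (x : G ⧸ H) (u v : TangentSpace 𝓘(ℝ, F) x) :
    D₀.torsion (a • x) (translDeriv H a x u) (translDeriv H a x v)
      = translDeriv H a x (D₀.torsion x u v) := by
  have hU := isSmoothField_smoothExtend u
  have hV := isSmoothField_smoothExtend v
  have hU' := isSmoothField_pushField E a hU
  have hV' := isSmoothField_pushField E a hV
  have h1 := D₀.torsion_apply (hU.mdifferentiable (by simp) x) (hV.mdifferentiable (by simp) x)
  have h2 := D₀.torsion_apply (hU'.mdifferentiable (by simp) (a • x))
    (hV'.mdifferentiable (by simp) (a • x))
  rw [translDeriv_mlieBracket E a hU hV] at h2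
  simp only [pushField_smul, smoothExtend_self] at h1 h2
  rw [h1, h2, hD₀ a _ _ hU hU' (pushField_smul a _), hD₀ a _ _ hV hV' (pushField_smul a _),
    map_sub, map_sub]

variable [RiemannianBundle (fun x : G ⧸ H ↦ TangentSpace 𝓘(ℝ, F) x)]
  [IsContMDiffRiemannianBundle 𝓘(ℝ, F) ∞ F (fun x : G ⧸ H ↦ TangentSpace 𝓘(ℝ, F) x)]

lemma IsAdaptedSection.mvfderiv_inner (hσ : IsAdaptedSection (F := F) H 𝔪 σ)
    (hD₀ : IsCanonicalConnection H D₀ 𝔪) (hmetric : IsInvariantMetric (F := F) H)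
    {Y Z : Π y : G ⧸ H, TangentSpace 𝓘(ℝ, F) y}
    (hY : MDiffAt (T% Y) ((1 : G) : G ⧸ H)) (hZ : MDiffAt (T% Z) ((1 : G) : G ⧸ H))
    (u : TangentSpace 𝓘(ℝ, F) ((1 : G) : G ⧸ H)) :
    mvfderiv 𝓘(ℝ, F) (fun y ↦ (inner ℝ (Y y) (Z y) : ℝ)) ((1 : G) : G ⧸ H) u
      = inner ℝ (D₀ Y ((1 : G) : G ⧸ H) u) (Z ((1 : G) : G ⧸ H))
        + inner ℝ (Y ((1 : G) : G ⧸ H)) (D₀ Z ((1 : G) : G ⧸ H) u) := by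
  let T : TangentSpace 𝓘(ℝ, F) ((1 : G) : G ⧸ H) →L[ℝ]
    TangentSpace 𝓘(ℝ, F) ((1 : G) : G ⧸ H) →L[ℝ] ℝ := innerSL ℝ
  exact hσ.mvfderiv_invariant hD₀ (B := fun y v w ↦ (inner ℝ v w : ℝ)) hmetric T
    (fun v w ↦ rfl) hY hZ u

/-- The canonical connection is metric. -/
lemma IsAdaptedSection.mvfderiv_inner_translate (hσ : IsAdaptedSection (F := F) H 𝔪 σ)
    (hD₀ : IsCanonicalConnection H D₀ 𝔪) (hmetric : IsInvariantMetric (F := F) H)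
    {Y Z : Π y : G ⧸ H, TangentSpace 𝓘(ℝ, F) y} (hY : IsSmoothField Y) (hZ : IsSmoothField Z)
    (a : G) (u : TangentSpace 𝓘(ℝ, F) ((1 : G) : G ⧸ H)) :
    mvfderiv 𝓘(ℝ, F) (fun y ↦ (inner ℝ (pushField a Y y) (pushField a Z y) : ℝ))
        (a • ((1 : G) : G ⧸ H)) (translDeriv H a _ u)
      = inner ℝ (D₀ Y ((1 : G) : G ⧸ H) u) (Z ((1 : G) : G ⧸ H))
        + inner ℝ (Y ((1 : G) : G ⧸ H)) (D₀ Z ((1 : G) : G ⧸ H) u) := by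
  rw [← hσ.mvfderiv_inner hD₀ hmetric (hY.mdifferentiable (by simp) _)
    (hZ.mdifferentiable (by simp) _)]
  have hd : MDiffAt (fun y ↦ (inner ℝ (pushField a Y y) (pushField a Z y) : ℝ))
      (a • ((1 : G) : G ⧸ H)) :=
    MDifferentiableAt.inner_bundle (IB := 𝓘(ℝ, F)) (E := fun x : G ⧸ H ↦ TangentSpace 𝓘(ℝ, F) x)
      (b := fun y ↦ y) ((isSmoothField_pushField E a hY).mdifferentiable (by simp) _)
      ((isSmoothField_pushField E a hZ).mdifferentiable (by simp) _)
  have h1 := (hd.hasMFDerivAt.comp ((1 : G) : G ⧸ H)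
    ((contMDiff_translation E F H a).mdifferentiable (by simp) _).hasMFDerivAt).mfderiv
  have h2 : (fun y ↦ (inner ℝ (pushField a Y y) (pushField a Z y) : ℝ)) ∘ (fun y ↦ a • y)
      = fun y ↦ (inner ℝ (Y y) (Z y) : ℝ) := by
    funext y
    simp only [Function.comp_apply, pushField_smul]
    exact hmetric a y _ _
  rw [h2] at h1
  exact (congrArg (fun L : F →L[ℝ] ℝ ↦ L u) h1).symm

variable (hσ : IsAdaptedSection (F := F) H 𝔪 σ) (hD : IsLeviCivita D)
  (hD₀ : IsCanonicalConnection H D₀ 𝔪) (hmetric : IsInvariantMetric (F := F) H)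
include hσ hD hD₀ hmetric

/-- Both connections differentiate the metric by the Leibniz rule, so the difference is skew. For D₀
this is known at the origin and is carried to other points by translation. Skewness is needed at
every point because the invariance of D is not assumed but deduced from it. -/
lemma IsAdaptedSection.inner_difference_translate (a : G)
    (u v w : TangentSpace 𝓘(ℝ, F) ((1 : G) : G ⧸ H)) :
    inner ℝ (D.difference D₀ (a • ((1 : G) : G ⧸ H)) (translDeriv H a _ v) (translDeriv H a _ u))
        (translDeriv H a _ w)
      = - inner ℝ (translDeriv H a _ v) (D.difference D₀ (a • ((1 : G) : G ⧸ H))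
        (translDeriv H a _ w) (translDeriv H a _ u)) := by
  have hV := isSmoothField_smoothExtend v
  have hW := isSmoothField_smoothExtend w
  have hV' := isSmoothField_pushField E a hV
  have hW' := isSmoothField_pushField E a hW
  have h1 := hσ.mvfderiv_inner_translate hD₀ hmetric hV hW a u
  have h2 := hD.metric _ _ _ (translDeriv H a _ u)
    (hV'.mdifferentiable (by simp) (a • ((1 : G) : G ⧸ H)))
    (hW'.mdifferentiable (by simp) (a • ((1 : G) : G ⧸ H)))
  rw [h1, ← hmetric a, ← hmetric a _ (smoothExtend v _),
    ← hD₀.invariant a _ _ hV hV' (pushField_smul a _),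
    ← hD₀.invariant a _ _ hW hW' (pushField_smul a _), pushField_smul, pushField_smul] at h2
  have h3 := difference_apply D D₀ (hV'.mdifferentiable (by simp) (a • ((1 : G) : G ⧸ H)))
    (translDeriv H a _ u)
  have h4 := difference_apply D D₀ (hW'.mdifferentiable (by simp) (a • ((1 : G) : G ⧸ H)))
    (translDeriv H a _ u)
  rw [pushField_smul, smoothExtend_self] at h3 h4
  rw [smoothExtend_self, smoothExtend_self] at h2
  rw [h3, h4, inner_sub_left, inner_sub_right]
  linarith

/-- The difference of the two metric connections is skew-adjoint. -/
lemma IsAdaptedSection.inner_difference (x : G ⧸ H) (u v w : TangentSpace 𝓘(ℝ, F) x) :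
    inner ℝ (D.difference D₀ x v u) w = - inner ℝ v (D.difference D₀ x w u) := by
  obtain ⟨a, rfl⟩ : ∃ a : G, a • ((1 : G) : G ⧸ H) = x := by
    obtain ⟨a, rfl⟩ := QuotientGroup.mk_surjective x
    exact ⟨a, smul_origin H a⟩
  obtain ⟨u, rfl⟩ := translDeriv_surjective E a _ u
  obtain ⟨v, rfl⟩ := translDeriv_surjective E a _ v
  obtain ⟨w, rfl⟩ := translDeriv_surjective E a _ w
  exact hσ.inner_difference_translate hD hD₀ hmetric a u v w

/-- The difference of the Levi-Civita and the canonical connection is invariant. -/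
lemma IsAdaptedSection.difference_translDeriv (a : G) (x : G ⧸ H)
    (v u : TangentSpace 𝓘(ℝ, F) x) :
    D.difference D₀ (a • x) (translDeriv H a x v) (translDeriv H a x u)
      = translDeriv H a x (D.difference D₀ x v u) := by
  have key : ∀ u v w : TangentSpace 𝓘(ℝ, F) x,
      (inner ℝ (D.difference D₀ (a • x) (translDeriv H a x v) (translDeriv H a x u)
        - translDeriv H a x (D.difference D₀ x v u)) (translDeriv H a x w) : ℝ) = 0 := by
    -- Uniqueness as for the Levi-Civita connection: the failure of invariance is skew in (v, w)
    -- because the tensor is skew at both points, and symmetric in (u, v) because the torsion of D₀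
    -- is invariant. Such a form is zero.
    refine eq_zero_of_skew_of_symm (fun u v w ↦ ?_) (fun u v w ↦ ?_)
    · rw [inner_sub_left, inner_sub_left, hmetric, hmetric,
        hσ.inner_difference hD hD₀ hmetric, hσ.inner_difference hD hD₀ hmetric x,
        real_inner_comm, real_inner_comm _ v]
      ring
    · have h1 := difference_sub_difference (D₀ := D₀) hD.torsion_eq_zero (translDeriv H a x u)
        (translDeriv H a x v)
      have h2 := difference_sub_difference (D₀ := D₀) hD.torsion_eq_zero u v
      rw [hD₀.invariant.torsion_translDeriv E] at h1
      have h3 := congrArg (translDeriv H a x) h2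
      rw [map_neg, map_sub, ← h1] at h3
      congr 1
      rw [sub_eq_sub_iff_add_eq_add] at h3 ⊢
      rw [← h3]; abel
  obtain ⟨w, hw⟩ := translDeriv_surjective E a x
    (D.difference D₀ (a • x) (translDeriv H a x v) (translDeriv H a x u)
        - translDeriv H a x (D.difference D₀ x v u))
  have h := key u v w
  rw [hw, inner_self_eq_zero] at h
  exact sub_eq_zero.1 h

end Invariance

/-! ### The curvature difference and the Codazzi equation at the origin. -/

section Curvature

variable {E : Type*} [NormedAddCommGroup E] [NormedSpace ℝ E] [CompleteSpace E]
  {F : Type*} [NormedAddCommGroup F] [NormedSpace ℝ F] [FiniteDimensional ℝ F] [CompleteSpace F]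
  {G : Type*} [TopologicalSpace G] [ChartedSpace E G] [Group G] [IsTopologicalGroup G]
  [LieGroup 𝓘(ℝ, E) ∞ G] {H : Subgroup G}
  [ChartedSpace F (G ⧸ H)] [IsManifold 𝓘(ℝ, F) ∞ (G ⧸ H)]
  [ContMDiffSMul 𝓘(ℝ, E) 𝓘(ℝ, F) ∞ G (G ⧸ H)] [T2Space (G ⧸ H)]
  {𝔪 : Submodule ℝ (GroupLieAlgebra 𝓘(ℝ, E) G)} {σ : G ⧸ H → G}
  {D D₀ : CovariantDerivative 𝓘(ℝ, F) F (TangentSpace 𝓘(ℝ, F) : G ⧸ H → Type _)}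
  [CovariantDerivative.ContMDiffCovariantDerivative D ∞]
  [CovariantDerivative.ContMDiffCovariantDerivative D₀ ∞]
  [RiemannianBundle (fun x : G ⧸ H ↦ TangentSpace 𝓘(ℝ, F) x)]
  [IsContMDiffRiemannianBundle 𝓘(ℝ, F) ∞ F (fun x : G ⧸ H ↦ TangentSpace 𝓘(ℝ, F) x)]
  (hσ : IsAdaptedSection (F := F) H 𝔪 σ) (hD : IsLeviCivita D)
  (hD₀ : IsCanonicalConnection H D₀ 𝔪) (hmetric : IsInvariantMetric (F := F) H)
include hσ hD hD₀ hmetric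

/-- The second covariant derivatives of the two connections at the origin. -/
lemma IsAdaptedSection.covariant_covariant {Y Z : Π y : G ⧸ H, TangentSpace 𝓘(ℝ, F) y}
    (hY : IsSmoothField Y) (hZ : IsSmoothField Z)
    (u : TangentSpace 𝓘(ℝ, F) ((1 : G) : G ⧸ H)) :
    D (fun y ↦ D Z y (Y y)) ((1 : G) : G ⧸ H) u
        - D₀ (fun y ↦ D₀ Z y (Y y)) ((1 : G) : G ⧸ H) u
      = D.difference D₀ _ (D₀ Z ((1 : G) : G ⧸ H) u) (Y ((1 : G) : G ⧸ H))
        + D.difference D₀ _ (Z ((1 : G) : G ⧸ H)) (D₀ Y ((1 : G) : G ⧸ H) u)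
        + D.difference D₀ _ (D₀ Z ((1 : G) : G ⧸ H) (Y ((1 : G) : G ⧸ H))) u
        + D.difference D₀ _ (D.difference D₀ _ (Z ((1 : G) : G ⧸ H)) (Y ((1 : G) : G ⧸ H))) u := by
  have hYd := hY.mdifferentiable (by simp) ((1 : G) : G ⧸ H)
  have hZd := hZ.mdifferentiable (by simp) ((1 : G) : G ⧸ H)
  have hP := mdifferentiableAt_cov D hZ hYd
  have hP₀ := mdifferentiableAt_cov D₀ hZ hYd
  have hQ : (fun y ↦ D.difference D₀ y (Z y) (Y y))
      = (fun y ↦ D Z y (Y y)) - fun y ↦ D₀ Z y (Y y) :=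
    funext fun y ↦ difference_apply D D₀ (hZ.mdifferentiable (by simp) y) (Y y)
  have hQd : MDiffAt (T% (fun y ↦ D.difference D₀ y (Z y) (Y y))) ((1 : G) : G ⧸ H) :=
    (congrArg (fun V : Π y : G ⧸ H, TangentSpace 𝓘(ℝ, F) y ↦ MDiffAt (T% V) ((1 : G) : G ⧸ H))
      hQ).mpr (mdifferentiableAt_sub_section hP hP₀)
  -- The difference tensor is invariant, hence parallel for D₀, so the derivative of S_Y Z involves
  -- only derivatives of Y and Z.
  have h1 := hσ.canonical_invariant_product hD₀ (S := D.difference D₀)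
    (hσ.difference_translDeriv hD hD₀ hmetric) hZd hYd hQd u
  have hPQ : (fun y ↦ D Z y (Y y))
      = (fun y ↦ D₀ Z y (Y y)) + fun y ↦ D.difference D₀ y (Z y) (Y y) := by
    rw [hQ]; abel
  have h2 := congrArg (fun L ↦ L u) (D₀.isCovariantDerivativeOnUniv.add hP₀ hQd)
  rw [← hPQ] at h2
  simp only [add_apply] at h2
  have h3 := difference_apply D D₀ hP u
  have h4 := difference_apply D D₀ hZd (Y ((1 : G) : G ⧸ H))
  rw [sub_eq_iff_eq_add.1 h3.symm, h2, h1, sub_eq_iff_eq_add.1 h4.symm]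
  simp only [map_add, add_apply]
  abel

/-- On alternating the second derivatives in u and v, the terms S_v(∇⁰_u w) + S_u(∇⁰_v w) cancel by
symmetry. The remaining first-order terms combine with the bracket term, since D is torsion-free,
into -S_{S_u v - S_v u} w. -/
lemma IsAdaptedSection.curvatureDiff_apply (u v w : TangentSpace 𝓘(ℝ, F) ((1 : G) : G ⧸ H)) :
    curvatureDiff D D₀ ((1 : G) : G ⧸ H) w u v
      = D.difference D₀ _ (D.difference D₀ _ w v) u - D.difference D₀ _ (D.difference D₀ _ w u) v
        - D.difference D₀ _ w (D.difference D₀ _ v u - D.difference D₀ _ u v) := by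
  have hU := isSmoothField_smoothExtend u
  have hV := isSmoothField_smoothExtend v
  have hW := isSmoothField_smoothExtend w
  have hUd := hU.mdifferentiable (by simp) ((1 : G) : G ⧸ H)
  have hVd := hV.mdifferentiable (by simp) ((1 : G) : G ⧸ H)
  have hWd := hW.mdifferentiable (by simp) ((1 : G) : G ⧸ H)
  have h1 := curvature_apply D hUd hVd w
  have h2 := curvature_apply D₀ hUd hVd w
  have h3 := hσ.covariant_covariant hD hD₀ hmetric hV hW u
  have h4 := hσ.covariant_covariant hD hD₀ hmetric hU hW v
  have h5 := difference_apply D D₀ hWd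
    (mlieBracket 𝓘(ℝ, F) (smoothExtend u) (smoothExtend v) ((1 : G) : G ⧸ H))
  have h6 := covariant_sub_eq_mlieBracket hD.torsion_eq_zero hUd hVd
  have h7 := difference_apply D D₀ hVd u
  have h8 := difference_apply D D₀ hUd v
  simp only [curvatureOp, smoothExtend_self] at h1 h2 h3 h4 h5 h6 h7 h8
  have h9 : curvatureDiff D D₀ ((1 : G) : G ⧸ H) w u v
      = curvature D _ w u v - curvature D₀ _ w u v := rfl
  rw [h9, h1, h2]
  rw [sub_eq_iff_eq_add] at h3 h4
  rw [h3, h4, sub_eq_iff_eq_add.1 h5.symm, h6, h7, h8]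
  simp only [map_sub]
  abel

/-- The difference of the connections at the origin and an invariant Codazzi tensor satisfy the
algebraic Codazzi equations. -/
lemma IsAdaptedSection.isAlgCodazzi
    {A : Π x : G ⧸ H, TangentSpace 𝓘(ℝ, F) x →L[ℝ] TangentSpace 𝓘(ℝ, F) x →L[ℝ] ℝ}
    (hA : IsCodazzi D A) (hAinv : IsInvariantTensor H A)
    {S : TangentSpace 𝓘(ℝ, F) ((1 : G) : G ⧸ H) →ₗ[ℝ] TangentSpace 𝓘(ℝ, F) ((1 : G) : G ⧸ H) →ₗ[ℝ]
      TangentSpace 𝓘(ℝ, F) ((1 : G) : G ⧸ H)}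
    (hS : ∀ u v, S u v = D.difference D₀ _ v u)
    {a : TangentSpace 𝓘(ℝ, F) ((1 : G) : G ⧸ H) →ₗ[ℝ] TangentSpace 𝓘(ℝ, F) ((1 : G) : G ⧸ H) →ₗ[ℝ]
      ℝ}
    (ha : ∀ u v, a u v = A _ u v) : IsAlgCodazzi S a where
  skew x y z := by
    rw [hS, hS]
    exact hσ.inner_difference hD hD₀ hmetric _ x y z
  symm x y := by
    rw [ha, ha]
    exact hA.symm _ x y
  codazzi x y z := by
    have hX := isSmoothField_smoothExtend x
    have hY := isSmoothField_smoothExtend y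
    have hZ := isSmoothField_smoothExtend z
    have hXd := hX.mdifferentiable (by simp) ((1 : G) : G ⧸ H)
    have hYd := hY.mdifferentiable (by simp) ((1 : G) : G ⧸ H)
    have hZd := hZ.mdifferentiable (by simp) ((1 : G) : G ⧸ H)
    have key : ∀ {Y Z : Π y : G ⧸ H, TangentSpace 𝓘(ℝ, F) y},
        MDiffAt (T% Y) ((1 : G) : G ⧸ H) → MDiffAt (T% Z) ((1 : G) : G ⧸ H) → ∀ u,
        mvfderiv 𝓘(ℝ, F) (fun y ↦ A y (Y y) (Z y)) ((1 : G) : G ⧸ H) u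
          = A _ (D₀ Y ((1 : G) : G ⧸ H) u) (Z ((1 : G) : G ⧸ H))
            + A _ (Y ((1 : G) : G ⧸ H)) (D₀ Z ((1 : G) : G ⧸ H) u) := fun hY hZ u ↦
      hσ.mvfderiv_invariant hD₀ (B := fun y v w ↦ A y v w) hAinv (A ((1 : G) : G ⧸ H))
        (fun v w ↦ rfl) hY hZ u
    have h := hA.codazzi _ _ _ hX hY hZ ((1 : G) : G ⧸ H)
    have h1 := difference_apply D D₀ hYd x
    have h2 := difference_apply D D₀ hZd x
    have h3 := difference_apply D D₀ hXd y
    have h4 := difference_apply D D₀ hZd y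
    rw [key hYd hZd, key hXd hZd] at h
    simp only [smoothExtend_self] at h h1 h2 h3 h4
    rw [sub_eq_iff_eq_add.1 h1.symm, sub_eq_iff_eq_add.1 h2.symm, sub_eq_iff_eq_add.1 h3.symm,
      sub_eq_iff_eq_add.1 h4.symm] at h
    simp only [map_add, add_apply] at h
    simp only [hS, ha]
    linarith

end Curvature

end CodazziHomogeneous

/-! ### Transfer of the algebraic model to the geometric statement. -/

theorem proposition3p3
    {E : Type*} [NormedAddCommGroup E] [NormedSpace ℝ E] [FiniteDimensional ℝ E]
    {F : Type*} [NormedAddCommGroup F] [NormedSpace ℝ F] [FiniteDimensional ℝ F] [CompleteSpace F]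
    -- a Lie group `G` and a closed subgroup `H`
    {G : Type*} [TopologicalSpace G] [ChartedSpace E G] [Group G] [IsTopologicalGroup G]
    [LieGroup 𝓘(ℝ, E) ∞ G]
    (H : Subgroup G) [IsClosed (H : Set G)]
    -- the smooth structure of `G/H`: the action is smooth, the projection is a submersion
    [ChartedSpace F (G ⧸ H)] [IsManifold 𝓘(ℝ, F) ∞ (G ⧸ H)]
    [ContMDiffSMul 𝓘(ℝ, E) 𝓘(ℝ, F) ∞ G (G ⧸ H)]
    (hπ : ∀ g : G, Function.Surjective (CodazziHomogeneous.projDeriv (E := E) (F := F) H g))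
    (𝔪 : Submodule ℝ (GroupLieAlgebra 𝓘(ℝ, E) G))
    (h𝔪 : CodazziHomogeneous.IsReductiveDecomposition (F := F) H 𝔪)
    -- a `G`-invariant Riemannian metric
    [RiemannianBundle (fun x : G ⧸ H ↦ TangentSpace 𝓘(ℝ, F) x)]
    [IsContMDiffRiemannianBundle 𝓘(ℝ, F) ∞ F (fun x : G ⧸ H ↦ TangentSpace 𝓘(ℝ, F) x)]
    (hmetric : CodazziHomogeneous.IsInvariantMetric (F := F) H)
    -- its Levi-Civita connection, and the canonical connection of second kind
    (D D₀ : CovariantDerivative 𝓘(ℝ, F) F (TangentSpace 𝓘(ℝ, F) : G ⧸ H → Type _))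
    [CovariantDerivative.ContMDiffCovariantDerivative D ∞]
    [CovariantDerivative.ContMDiffCovariantDerivative D₀ ∞]
    (hD : CodazziHomogeneous.IsLeviCivita D)
    (hD₀ : CodazziHomogeneous.IsCanonicalConnection H D₀ 𝔪)
    -- a `G`-invariant Codazzi tensor field
    (A : Π x : G ⧸ H, TangentSpace 𝓘(ℝ, F) x →L[ℝ] TangentSpace 𝓘(ℝ, F) x →L[ℝ] ℝ)
    (hA : CodazziHomogeneous.IsCodazzi D A)
    (hAinv : CodazziHomogeneous.IsInvariantTensor H A)
    -- its eigenvalues at `eH`, in increasing order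
    (r : ℕ) (ev : Fin r → ℝ) (hmono : StrictMono ev)
    (hev : ∀ μ : ℝ, μ ∈ Set.range ev ↔
      CodazziHomogeneous.eigenspace ((1 : G) : G ⧸ H) (A ((1 : G) : G ⧸ H)) μ ≠ ⊥) :
    -- the difference curvature restricts to each eigenspace, so that the leaves have difference
    -- Ricci and scalar curvatures
    ∃ hinv : ∀ i : Fin r, CodazziHomogeneous.IsDiffInvariant D D₀ ((1 : G) : G ⧸ H)
        (CodazziHomogeneous.eigenspace ((1 : G) : G ⧸ H) (A ((1 : G) : G ⧸ H)) (ev i)),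
      (∀ j : Fin r, (j : ℕ) = 0 ∨ (j : ℕ) + 1 = r →
        ∀ Y : CodazziHomogeneous.eigenspace ((1 : G) : G ⧸ H) (A ((1 : G) : G ⧸ H)) (ev j),
          CodazziHomogeneous.ricciDiff D D₀ ((1 : G) : G ⧸ H) Y Y
            ≤ CodazziHomogeneous.leafRicciDiff D D₀ ((1 : G) : G ⧸ H) _ (hinv j) Y Y) ∧
      ∑ i : Fin r, CodazziHomogeneous.leafScalarDiff D D₀ ((1 : G) : G ⧸ H) _ (hinv i)
        = CodazziHomogeneous.scalarDiff D D₀ ((1 : G) : G ⧸ H) := by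
  -- The quotient is Hausdorff because H is closed.
  have : T2Space (G ⧸ H) := inferInstance
  have : CompleteSpace E := FiniteDimensional.complete ℝ E
  obtain ⟨σ, hσ⟩ := h𝔪.exists_isAdaptedSection (hπ 1)
  set o : G ⧸ H := ((1 : G) : G ⧸ H) with ho
  let S : TangentSpace 𝓘(ℝ, F) o →ₗ[ℝ] TangentSpace 𝓘(ℝ, F) o →ₗ[ℝ] TangentSpace 𝓘(ℝ, F) o :=
    -- The arguments are exchanged, since `difference` takes the differentiated vector first,
    -- whereas the direction is to be the first argument of S.
    LinearMap.mk₂ ℝ (fun u v ↦ D.difference D₀ o v u) (by simp) (by simp) (by simp) (by simp)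
  let a : TangentSpace 𝓘(ℝ, F) o →ₗ[ℝ] TangentSpace 𝓘(ℝ, F) o →ₗ[ℝ] ℝ :=
    LinearMap.mk₂ ℝ (fun u v ↦ A o u v) (by simp) (by simp) (by simp) (by simp)
  have hSa : CodazziHomogeneous.IsAlgCodazzi S a :=
    hσ.isAlgCodazzi hD hD₀ hmetric hA hAinv (fun _ _ ↦ rfl) (fun _ _ ↦ rfl)
  have hcurv : ∀ u v w : TangentSpace 𝓘(ℝ, F) o, CodazziHomogeneous.curvatureDiff D D₀ o w u v
      = CodazziHomogeneous.algCurvature S v w u := by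
    intro u v w
    rw [CodazziHomogeneous.algCurvature_apply]
    exact hσ.curvatureDiff_apply hD hD₀ hmetric u v w
  have hfix : ∀ v w : TangentSpace 𝓘(ℝ, F) o, CodazziHomogeneous.fixSecond
      (CodazziHomogeneous.curvatureDiff D D₀ o w) v = CodazziHomogeneous.algCurvature S v w :=
    fun v w ↦ LinearMap.ext fun u ↦ hcurv u v w
  have hric : ∀ v w : TangentSpace 𝓘(ℝ, F) o, CodazziHomogeneous.ricciDiff D D₀ o v w
      = LinearMap.trace ℝ _ (CodazziHomogeneous.algCurvature S v w) := by
    intro v w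
    rw [← hfix, CodazziHomogeneous.ricciDiff, CodazziHomogeneous.ricci, CodazziHomogeneous.ricci,
      ← map_sub]
    rfl
  let m : Fin r → Submodule ℝ (TangentSpace 𝓘(ℝ, F) o) := fun i ↦
    CodazziHomogeneous.eigenspace o (A o) (ev i)
  have hm : ∀ i u, u ∈ m i ↔ ∀ v, a u v = ev i * inner ℝ u v := fun i u ↦ Iff.rfl
  have hev' : ∀ (μ : ℝ) (u : TangentSpace 𝓘(ℝ, F) o), u ≠ 0 →
      (∀ v, a u v = μ * inner ℝ u v) → μ ∈ Set.range ev := fun μ u hu h ↦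
    (hev μ).2 fun hbot ↦ hu ((Submodule.mem_bot ℝ).1 (hbot ▸ (h : u ∈
      CodazziHomogeneous.eigenspace o (A o) μ)))
  have hinv : ∀ i, CodazziHomogeneous.IsDiffInvariant D D₀ o (m i) := fun i v hv w hw u hu ↦ by
    rw [hcurv]
    exact hSa.algCurvature_mem hmono hm hev' hv hw hu
  refine ⟨hinv, fun j hj Y ↦ ?_, ?_⟩
  · rw [hric]
    refine (hSa.trace_le_trace hmono hm hev' hj Y.2
      (fun u hu ↦ hSa.algCurvature_mem hmono hm hev' Y.2 Y.2 hu)).trans_eq ?_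
    congr 1
    ext u
    exact (hcurv u Y Y).symm
  · have h1 := hSa.sum_trace_eq hmono hm hev'
      (fun i v hv w hw u hu ↦ hSa.algCurvature_mem hmono hm hev' hv hw hu)
    refine Eq.trans (Finset.sum_congr rfl fun i _ ↦ ?_) (h1.trans ?_)
    · refine congrArg CodazziHomogeneous.metricTrace (funext fun v ↦ funext fun w ↦ ?_)
      refine congrArg (fun T : m i →ₗ[ℝ] m i ↦ LinearMap.trace ℝ (m i) T)
        (LinearMap.ext fun u ↦ Subtype.ext ?_)
      exact hcurv _ _ _
    · refine (congrArg CodazziHomogeneous.metricTrace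
        (funext fun v ↦ funext fun w ↦ (hric v w).symm)).trans ?_
      -- Both scalar curvatures are sums over the same standard basis, so they may be subtracted
      -- term by term.
      exact Finset.sum_sub_distrib
        (fun b ↦ CodazziHomogeneous.ricci D o (stdOrthonormalBasis ℝ _ b)
          (stdOrthonormalBasis ℝ _ b))
        (fun b ↦ CodazziHomogeneous.ricci D₀ o (stdOrthonormalBasis ℝ _ b)
          (stdOrthonormalBasis ℝ _ b))
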